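/- Let $\mathbb{R}^4_2$ be $\mathbb{R}^4\cong\mathbb{C}^2$, $(x_1,x_2,x_3,x_4)\leftrightarrow(z,w)=(x_1+ix_2,\,x_3+ix_4)$, with the inner product $\langle v,v'\rangle=v_1v'_1+v_2v'_2-v_3v'_3-v_4v'_4$, and let $\mathrm{SL}(2,\mathbb{R})=\{(z,w): |z|^2-|w|^2=1\}\subset\mathbb{R}^4_2$. Consider the tangent vector fields $X_1(z,w)=(iz,iw)$ (the Hopf vector field), $X_2(z,w)=(i\bar w,i\bar z)$, $X_3(z,w)=(\bar w,\bar z)$. For $\tau>0$ let $g_\tau(X,Y)=-\langle X,Y\rangle+(1+\tau^2)\langle X,X_1\rangle\langle Y,X_1\rangle$; this is a Riemannian metric on $\mathrm{SL}(2,\mathbb{R})$, with orthonormal frame $E_1=-\tau^{-1}X_1$, $E_2=X_2$, $E_3=X_3$. Let $\nabla$ be its Levi-Civita connection and $R(X,Y)Z=\nabla_X\nabla_YZ-\nabla_Y\nabla_XZ-\nabla_{[X,Y]}Z$. Let $I\subset\mathbb{R}$ be a non-empty open interval and let $\gamma:I\to\mathrm{SL}(2,\mathbb{R})\subset\mathbb{R}^4_2$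 be a smooth curve parametrized by arc length with respect to $g_\tau$; put $T=\gamma'$. The curve is called biharmonic if its bitension field vanishes identically, i.e. $\nabla_T\nabla_T\nabla_TT-R(T,\nabla_TT)T=0$ on $I$, and proper biharmonic if it is biharmonic and not a geodesic (that is, $\nabla_TT$ is not identically zero). For $\vartheta\in[0,\pi]$ with $\frac{4(1+\tau^2)}{4+5\tau^2}\le\cos^2\vartheta<1$ and a choice of sign put $$b=-\tau^{-1}(2+\tau^2)\cos\vartheta\pm\sqrt{(4+5\tau^2)\cos^2\vartheta-4(1+\tau^2)},$$ $$a=\tfrac12\bigl(-\tau^{-2}+1-(1+\tau^{-2})\cos2\vartheta\bigr)-\tau^{-1}\cos\vartheta\; b.$$ Then $\gamma$ is proper biharmonic if and only if there are $\vartheta\in[0,\pi]$ with $\frac{4(1+\tau^2)}{4+5\tau^2}\le\cos^2\vartheta<1$ and a sign in the definition of $b$ such that $\gamma$ makes the constant angle $\vartheta$ with the unit Hopf field $E_1$ (that is, $g_\tau(T,E_1)=\cos\vartheta$ on $I$) and, as a curve in $\mathbb{R}^4_2$, satisfies $$\gamma''''+(b^2-2a)\,\gamma''+a^2\,\gamma=0\quad\text{on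 } I.$$ Moreover, for every such $\vartheta$ and sign there is a smooth function $\beta:I\to\mathbb{R}$ with $$T=\cos\vartheta\,E_1+\sin\vartheta\sin\beta\,E_2+\sin\vartheta\cos\beta\,E_3\quad\text{and}\quad\beta'=b\quad\text{on } I.$$ -/

import Mathlib

open scoped ContDiff

noncomputable section

namespace SLBiharmonic

/-- The ambient space `ℝ⁴`, with coordinates `(x₁, x₂, x₃, x₄)`, identified with `ℂ²` through
`z = x₁ + i x₂`, `w = x₃ + i x₄`. -/
abbrev R4 : Type := Fin 4 → ℝ

/-- The pseudo-Euclidean inner product of signature `(2, 2)` of `ℝ⁴₂`. -/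
def pseudoInner (v w : R4) : ℝ := v 0 * w 0 + v 1 * w 1 - v 2 * w 2 - v 3 * w 3

/-- `SL(2, ℝ)` as the quadric `|z|² - |w|² = 1` of `ℝ⁴₂`. -/
def SL2 : Set R4 := {v | pseudoInner v v = 1}

/-- The Hopf vector field `X₁(z, w) = (i z, i w)`. -/
def X1 (p : R4) : R4 := ![-p 1, p 0, -p 3, p 2]

/-- `X₂(z, w) = (i w̄, i z̄)`. -/
def X2 (p : R4) : R4 := ![p 3, p 2, p 1, p 0]

/-- `X₃(z, w) = (w̄, z̄)`. -/
def X3 (p : R4) : R4 := ![p 2, -p 3, p 0, -p 1]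

/-- The metric `g_τ` at the point `p`, which makes `X₁, X₂, X₃` orthogonal, of lengths `τ, 1, 1`. -/
def metric (τ : ℝ) (p u v : R4) : ℝ :=
  -pseudoInner u v + (1 + τ ^ 2) * pseudoInner u (X1 p) * pseudoInner v (X1 p)

/-- The orthonormal frame `E₁ = -τ⁻¹ X₁, E₂ = X₂, E₃ = X₃` of `(SL(2, ℝ), g_τ)`
(indexed by `0, 1, 2`). -/
def frame (τ : ℝ) (i : Fin 3) (p : R4) : R4 := ![-τ⁻¹ • X1 p, X2 p, X3 p] i

/-- The right-hand side of the Koszul formula, i.e. `g_τ(∇_X Y, Z)` at `p`. Vector fields on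
`SL(2, ℝ)` are given as fields on `ℝ⁴` that are tangent to `SL(2, ℝ)` along it; all derivatives
are taken in tangent directions and the brackets are brackets of tangent fields, so that on
`SL(2, ℝ)` the value depends only on the restrictions of the fields to `SL(2, ℝ)`. -/
def koszul (τ : ℝ) (X Y Z : R4 → R4) (p : R4) : ℝ :=
  (1 / 2) *
    (fderiv ℝ (fun q => metric τ q (Y q) (Z q)) p (X p)
      + fderiv ℝ (fun q => metric τ q (Z q) (X q)) p (Y p)
      - fderiv ℝ (fun q => metric τ q (X q) (Y q)) p (Z p)
      + metric τ p (VectorField.lieBracket ℝ X Y p) (Z p)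
      - metric τ p (VectorField.lieBracket ℝ Y Z p) (X p)
      + metric τ p (VectorField.lieBracket ℝ Z X p) (Y p))

/-- The Levi-Civita connection `∇_X Y` of `(SL(2, ℝ), g_τ)`: the tangent vector field whose
components in the orthonormal frame are given by the Koszul formula. -/
def nabla (τ : ℝ) (X Y : R4 → R4) (p : R4) : R4 :=
  ∑ k : Fin 3, koszul τ X Y (frame τ k) p • frame τ k p

/-- The curvature `R(X, Y) Z = ∇_X ∇_Y Z - ∇_Y ∇_X Z - ∇_[X, Y] Z`. -/
def curvature (τ : ℝ) (X Y Z : R4 → R4) (p : R4) : R4 :=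
  nabla τ X (nabla τ Y Z) p - nabla τ Y (nabla τ X Z) p
    - nabla τ (VectorField.lieBracket ℝ X Y) Z p

/-- The extension of a tangent vector `u` at `p` to the vector field that has constant components
in the frame. -/
def frameExt (τ : ℝ) (p u : R4) (q : R4) : R4 :=
  ∑ i : Fin 3, metric τ p u (frame τ i p) • frame τ i q

/-- The curvature tensor at `p`, on tangent vectors. -/
def curvatureAt (τ : ℝ) (p u v w : R4) : R4 :=
  curvature τ (frameExt τ p u) (frameExt τ p v) (frameExt τ p w) p

/-- The covariant derivative `∇_{γ'} V` of a vector field `V` along the curve `γ`. With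
`V = ∑ V_k E_k` it is `∑ V_k' E_k + ∑ V_k ∇_{γ'} E_k`. -/
def covDeriv (τ : ℝ) (γ : ℝ → R4) (V : ℝ → R4) (s : ℝ) : R4 :=
  (∑ k : Fin 3, deriv (fun r => metric τ (γ r) (V r) (frame τ k (γ r))) s • frame τ k (γ s))
    + nabla τ (frameExt τ (γ s) (deriv γ s)) (frameExt τ (γ s) (V s)) (γ s)

/-- The tension field `∇_{γ'} γ'` of the curve `γ`. -/
def tension (τ : ℝ) (γ : ℝ → R4) : ℝ → R4 := covDeriv τ γ (deriv γ)

/-- The bitension field `-Δ^γ τ(γ) - R(γ', τ(γ)) γ'` of the curve `γ`; the rough Laplacian along a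
curve is `-(∇_{γ'})²`. -/
def bitension (τ : ℝ) (γ : ℝ → R4) (s : ℝ) : R4 :=
  covDeriv τ γ (covDeriv τ γ (tension τ γ)) s
    - curvatureAt τ (γ s) (deriv γ s) (tension τ γ s) (deriv γ s)

/-- The curve `γ` is proper biharmonic on `I`: its bitension field vanishes, and it is not a
geodesic. -/
def IsProperBiharmonicOn (τ : ℝ) (γ : ℝ → R4) (I : Set ℝ) : Prop :=
  (∀ s ∈ I, bitension τ γ s = 0) ∧ ¬ ∀ s ∈ I, tension τ γ s = 0

/-- The curve `γ` (parametrized by arc length) makes the constant angle `ϑ` with the unit Hopf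
field `E₁`. -/
def HasHopfAngleOn (τ : ℝ) (γ : ℝ → R4) (I : Set ℝ) (ϑ : ℝ) : Prop :=
  ∀ s ∈ I, metric τ (γ s) (deriv γ s) (frame τ 0 (γ s)) = Real.cos ϑ

/-- The constant `b`, with the sign `ε = ±1` in front of the square root. -/
def bConst (τ ϑ ε : ℝ) : ℝ :=
  -τ⁻¹ * (2 + τ ^ 2) * Real.cos ϑ
    + ε * Real.sqrt ((4 + 5 * τ ^ 2) * Real.cos ϑ ^ 2 - 4 * (1 + τ ^ 2))

/-- The constant `a`. -/
def aConst (τ ϑ ε : ℝ) : ℝ :=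
  (1 / 2) * (-(τ ^ 2)⁻¹ + 1 - (1 + (τ ^ 2)⁻¹) * Real.cos (2 * ϑ))
    - τ⁻¹ * Real.cos ϑ * bConst τ ϑ ε

/-- `γ` makes the constant angle `ϑ` with the Hopf field, `ϑ` lies in the admissible range, and `γ`
solves `γ⁗ + (b² - 2a) γ'' + a² γ = 0` in `ℝ⁴` with the constants `a, b` of `τ`, `ϑ` and the
sign `ε`. -/
def SatisfiesODEOn (τ : ℝ) (γ : ℝ → R4) (I : Set ℝ) (ϑ ε : ℝ) : Prop :=
  HasHopfAngleOn τ γ I ϑ ∧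
  4 * (1 + τ ^ 2) / (4 + 5 * τ ^ 2) ≤ Real.cos ϑ ^ 2 ∧ Real.cos ϑ ^ 2 < 1 ∧
  ∀ s ∈ I, iteratedDeriv 4 γ s + (bConst τ ϑ ε ^ 2 - 2 * aConst τ ϑ ε) • iteratedDeriv 2 γ s
    + aConst τ ϑ ε ^ 2 • γ s = 0

end SLBiharmonic

end

/-! The frame is left-invariant, so in frame components everything becomes algebra on `ℝ³`: a field
with components `v` along the curve has covariant derivative `v' + connection τ T v`, where
`connection τ T` is skew, and the curvature is a fixed trilinear map.

From biharmonic to helix (`exists_helix_constants`): let `W = ∇_T T`, `Y = ∇_T W`, `B = T × W`.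
Differentiating `|T|² = 1` repeatedly gives `|W|² = K` constant and `K Y = -K² T + m B` with `m = Y
· B`. The equation then yields `m' = -4(1 + τ²) B₀ W₀` and `B₀' = (τ - m/K) W₀`, and a Gram
determinant ties `m²` to `B₀²`. Together they force `W₀ = 0`: the Hopf angle is constant, and `W = u
(0, T₂, -T₁)` with `u` constant. The Gram relation becomes a quadratic equation for `u`. Its
solvability over `ℝ` is the bound on `cos² ϑ`, its roots give the two signs, and `b = u - (2τ +
2τ⁻¹) cos ϑ` is the rate at which `T` turns about `E₁`. Conversely, a curve turning at this rate
solves the equation, and `u ≠ 0`.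

From helix to the equation in `ℝ⁴` (`fourth_order_iff`): the frame fields are linear maps that
multiply like split quaternions, so the derivatives of a curve of constant Hopf angle and turning
rate `f` expand in `γ, E₁, E₂, E₃`. The fourth order equation splits into `f' = 0`, an equation
giving `f² = b²`, and a third one that excludes `f = -b` unless `b = 0`. A constant rate integrates
to a linear angle `β`. -/

noncomputable section

namespace SLBiharmonic

open Filter Topology

/-! ### Calculus of fields with invariant components -/

/-- The frame field `frame τ i` as a linear map. -/
def frameCLM (τ : ℝ) (i : Fin 3) : R4 →L[ℝ] R4 :=
  LinearMap.toContinuousLinearMap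
    { toFun := frame τ i
      map_add' := fun p q => by
        fin_cases i <;> ext j <;> fin_cases j <;> simp [frame, X1, X2, X3] <;> ring
      map_smul' := fun r p => by
        fin_cases i <;> ext j <;> fin_cases j <;> simp [frame, X1, X2, X3] <;> ring }

@[simp] theorem frameCLM_apply (τ : ℝ) (i : Fin 3) (p : R4) : frameCLM τ i p = frame τ i p := rfl

theorem hasFDerivAt_frame (τ : ℝ) (i : Fin 3) (p : R4) :
    HasFDerivAt (frame τ i) (frameCLM τ i) p :=
  (frameCLM τ i).hasFDerivAt

/-- The vector field with the components `x` in the frame. -/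
def comb (τ : ℝ) (x : Fin 3 → ℝ) (q : R4) : R4 := ∑ i, x i • frame τ i q

/-- Functions on `ℝ⁴` that are differentiable and have zero derivative along the frame. -/
def FrameInvariant (τ : ℝ) (f : R4 → ℝ) : Prop :=
  ∀ q, DifferentiableAt ℝ f q ∧ ∀ i, fderiv ℝ f q (frame τ i q) = 0

namespace FrameInvariant

variable {τ : ℝ} {f g : R4 → ℝ}

theorem const (τ c : ℝ) : FrameInvariant τ fun _ => c := fun q => by simp

theorem add (hf : FrameInvariant τ f) (hg : FrameInvariant τ g) :
    FrameInvariant τ fun q => f q + g q := fun q => by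
  refine ⟨(hf q).1.add (hg q).1, fun i => ?_⟩
  rw [fderiv_fun_add (hf q).1 (hg q).1]
  simp [(hf q).2, (hg q).2]

theorem mul (hf : FrameInvariant τ f) (hg : FrameInvariant τ g) :
    FrameInvariant τ fun q => f q * g q := fun q => by
  refine ⟨(hf q).1.mul (hg q).1, fun i => ?_⟩
  rw [fderiv_fun_mul (hf q).1 (hg q).1]
  simp [(hf q).2, (hg q).2]

theorem sub (hf : FrameInvariant τ f) (hg : FrameInvariant τ g) :
    FrameInvariant τ fun q => f q - g q := by
  simpa [sub_eq_add_neg] using hf.add ((const τ (-1)).mul hg)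

theorem fderiv_comb (hf : FrameInvariant τ f) (y : Fin 3 → ℝ) (q : R4) :
    fderiv ℝ f q (comb τ y q) = 0 := by
  simp [comb, (hf q).2]

/-- The frame is tangent to every level set of the quadratic form. Hence the metric coefficients,
which off `SL2` depend on `⟨q, q⟩`, are still constant along the frame. -/
theorem pseudoInner_self (τ : ℝ) : FrameInvariant τ fun q => pseudoInner q q := fun q => by
  have h : HasFDerivAt (fun q : R4 => pseudoInner q q) _ q :=
    (((((hasFDerivAt_apply (𝕜 := ℝ) 0 q).mul (hasFDerivAt_apply (𝕜 := ℝ) 0 q)).add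
      ((hasFDerivAt_apply (𝕜 := ℝ) 1 q).mul (hasFDerivAt_apply (𝕜 := ℝ) 1 q))).sub
      ((hasFDerivAt_apply (𝕜 := ℝ) 2 q).mul (hasFDerivAt_apply (𝕜 := ℝ) 2 q))).sub
      ((hasFDerivAt_apply (𝕜 := ℝ) 3 q).mul (hasFDerivAt_apply (𝕜 := ℝ) 3 q)))
  refine ⟨h.differentiableAt, fun i => ?_⟩
  rw [h.fderiv]
  fin_cases i <;> simp [frame, X1, X2, X3] <;> ring

end FrameInvariant

theorem hasFDerivAt_comb {τ : ℝ} {x : Fin 3 → R4 → ℝ} (hx : ∀ i, FrameInvariant τ (x i)) (q : R4) :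
    HasFDerivAt (fun q => comb τ (fun i => x i q) q)
      (∑ i, (x i q • frameCLM τ i + (fderiv ℝ (x i) q).smulRight (frame τ i q))) q := by
  unfold comb
  exact HasFDerivAt.fun_sum fun i _ =>
    ((hx i q).1.hasFDerivAt).smul (hasFDerivAt_frame τ i q)

/-- The bracket of `sl(2, ℝ)` in the orthonormal frame. -/
def bracket (τ : ℝ) (x y : Fin 3 → ℝ) : Fin 3 → ℝ :=
  ![2 * τ * (x 1 * y 2 - x 2 * y 1), -2 * τ⁻¹ * (x 2 * y 0 - x 0 * y 2),
    -2 * τ⁻¹ * (x 0 * y 1 - x 1 * y 0)]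

/-- Derivatives of the components drop out by invariance, which leaves the commutators of the linear
maps `frame τ i`. -/
theorem lieBracket_comb {τ : ℝ} (hτ : τ ≠ 0) {x y : Fin 3 → R4 → ℝ}
    (hx : ∀ i, FrameInvariant τ (x i)) (hy : ∀ i, FrameInvariant τ (y i)) (q : R4) :
    VectorField.lieBracket ℝ (fun q => comb τ (fun i => x i q) q)
      (fun q => comb τ (fun i => y i q) q) q
      = comb τ (bracket τ (fun i => x i q) (fun i => y i q)) q := by
  rw [VectorField.lieBracket, (hasFDerivAt_comb hx q).fderiv, (hasFDerivAt_comb hy q).fderiv]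
  simp only [_root_.sum_apply, _root_.add_apply,
    ContinuousLinearMap.smulRight_apply, (hx _).fderiv_comb, (hy _).fderiv_comb, zero_smul,
    add_zero, _root_.smul_apply, frameCLM_apply]
  simp only [comb, Fin.sum_univ_three, bracket]
  ext j
  fin_cases j <;> simp [frame, X1, X2, X3] <;> field_simp <;> ring

/-- The squared length of `E₁` with respect to `metric τ` at points with `⟨q, q⟩ = n`. -/
def hopfWeight (τ n : ℝ) : ℝ := (τ⁻¹ * τ⁻¹) * ((1 + τ * τ) * (n * n) - n)

/-- The metric in the frame, at points with `⟨q, q⟩ = n`. -/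
def frameMetric (τ n : ℝ) (x y : Fin 3 → ℝ) : ℝ :=
  hopfWeight τ n * (x 0 * y 0) + n * (x 1 * y 1 + x 2 * y 2)

theorem metric_comb (τ : ℝ) (x y : Fin 3 → ℝ) (q : R4) :
    metric τ q (comb τ x q) (comb τ y q) = frameMetric τ (pseudoInner q q) x y := by
  simp [metric, comb, Fin.sum_univ_three, frame, X1, X2, X3, pseudoInner, frameMetric, hopfWeight]
  ring

theorem FrameInvariant.frameMetric {τ : ℝ} {x y : Fin 3 → R4 → ℝ}
    (hx : ∀ i, FrameInvariant τ (x i)) (hy : ∀ i, FrameInvariant τ (y i)) :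
    FrameInvariant τ fun q => frameMetric τ (pseudoInner q q) (fun i => x i q) (fun i => y i q) := by
  have n := FrameInvariant.pseudoInner_self τ
  exact (((const τ _).mul (((const τ _).mul (n.mul n)).sub n)).mul ((hx 0).mul (hy 0))).add
    (n.mul (((hx 1).mul (hy 1)).add ((hx 2).mul (hy 2))))

/-- The right-hand side of the Koszul formula in the frame, at points with `⟨q, q⟩ = n`. -/
def frameKoszul (τ n : ℝ) (x y z : Fin 3 → ℝ) : ℝ :=
  (1 / 2) * (frameMetric τ n (bracket τ x y) z - frameMetric τ n (bracket τ y z) x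
    + frameMetric τ n (bracket τ z x) y)

theorem koszul_comb {τ : ℝ} (hτ : τ ≠ 0) {x y z : Fin 3 → R4 → ℝ}
    (hx : ∀ i, FrameInvariant τ (x i)) (hy : ∀ i, FrameInvariant τ (y i))
    (hz : ∀ i, FrameInvariant τ (z i)) (q : R4) :
    koszul τ (fun q => comb τ (fun i => x i q) q) (fun q => comb τ (fun i => y i q) q)
      (fun q => comb τ (fun i => z i q) q) q
      = frameKoszul τ (pseudoInner q q) (fun i => x i q) (fun i => y i q) (fun i => z i q) := by
  unfold koszul
  simp only [lieBracket_comb hτ hx hy, lieBracket_comb hτ hy hz, lieBracket_comb hτ hz hx,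
    metric_comb, (FrameInvariant.frameMetric hx hy).fderiv_comb,
    (FrameInvariant.frameMetric hy hz).fderiv_comb, (FrameInvariant.frameMetric hz hx).fderiv_comb]
  simp [frameKoszul]

theorem frame_eq_comb (τ : ℝ) (k : Fin 3) : frame τ k = comb τ (Pi.single k 1) := by
  funext q
  fin_cases k <;> simp [comb]

/-- Stated at all points of `ℝ⁴`: the outer derivative in `∇_X ∇_Y Z` differentiates the inner field
in the ambient space, so its values on `SL2` alone would not suffice. `FrameInvariant.frameKoszul`
then allows the iteration. -/
theorem nabla_comb {τ : ℝ} (hτ : τ ≠ 0) {x y : Fin 3 → R4 → ℝ}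
    (hx : ∀ i, FrameInvariant τ (x i)) (hy : ∀ i, FrameInvariant τ (y i)) :
    nabla τ (fun q => comb τ (fun i => x i q) q) (fun q => comb τ (fun i => y i q) q)
      = fun q => comb τ (fun k => frameKoszul τ (pseudoInner q q) (fun i => x i q)
          (fun i => y i q) (Pi.single k 1)) q := by
  funext q
  rw [nabla, comb]
  refine Finset.sum_congr rfl fun k _ => ?_
  rw [frame_eq_comb,
    koszul_comb hτ hx hy (z := fun i _ => (Pi.single k 1 : Fin 3 → ℝ) i) fun i => .const τ _]

theorem FrameInvariant.frameKoszul {τ : ℝ} {x y : Fin 3 → R4 → ℝ}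
    (hx : ∀ i, FrameInvariant τ (x i)) (hy : ∀ i, FrameInvariant τ (y i)) (z : Fin 3 → ℝ) :
    FrameInvariant τ fun q =>
      frameKoszul τ (pseudoInner q q) (fun i => x i q) (fun i => y i q) z := by
  have key : ∀ {x y : Fin 3 → R4 → ℝ}, (∀ i, FrameInvariant τ (x i)) →
      (∀ i, FrameInvariant τ (y i)) →
      ∀ i, FrameInvariant τ fun q => bracket τ (fun i => x i q) (fun i => y i q) i := by
    intro x y hx hy i
    fin_cases i
    · exact (const τ _).mul (((hx 1).mul (hy 2)).sub ((hx 2).mul (hy 1)))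
    · exact (const τ _).mul (((hx 2).mul (hy 0)).sub ((hx 0).mul (hy 2)))
    · exact (const τ _).mul (((hx 0).mul (hy 1)).sub ((hx 1).mul (hy 0)))
  have hz : ∀ i, FrameInvariant τ ((fun i _ => z i : Fin 3 → R4 → ℝ) i) := fun i => const τ _
  exact (const τ _).mul ((((FrameInvariant.frameMetric (key hx hy) hz).sub
    (FrameInvariant.frameMetric (key hy hz) hx))).add (FrameInvariant.frameMetric (key hz hx) hy))

/-! ### Connection and curvature on `SL2` -/

/-- The Levi-Civita connection in the orthonormal frame. -/
def connection (τ : ℝ) (x y : Fin 3 → ℝ) : Fin 3 → ℝ :=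
  ![τ * (x 1 * y 2 - x 2 * y 1), τ * x 2 * y 0 + (τ + 2 * τ⁻¹) * x 0 * y 2,
    -(τ + 2 * τ⁻¹) * x 0 * y 1 - τ * x 1 * y 0]

theorem frameKoszul_one {τ : ℝ} (hτ : τ ≠ 0) (x y : Fin 3 → ℝ) (k : Fin 3) :
    frameKoszul τ 1 x y (Pi.single k 1) = connection τ x y k := by
  have h : τ⁻¹ * τ = 1 := inv_mul_cancel₀ hτ
  have hw : hopfWeight τ 1 = 1 := by
    unfold hopfWeight; linear_combination (τ⁻¹ * τ + 1) * h
  fin_cases k <;> simp [frameKoszul, frameMetric, hw, bracket, connection] <;> ring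

theorem nabla_comb_const {τ : ℝ} (hτ : τ ≠ 0) (x y : Fin 3 → ℝ) {p : R4} (hp : p ∈ SL2) :
    nabla τ (comb τ x) (comb τ y) p = comb τ (connection τ x y) p := by
  have h := congrFun (nabla_comb hτ (x := fun i _ => x i) (y := fun i _ => y i)
    (fun i => .const τ _) (fun i => .const τ _)) p
  have hp' : pseudoInner p p = 1 := hp
  rw [hp'] at h
  simpa only [frameKoszul_one hτ] using h

theorem nabla_nabla_comb {τ : ℝ} (hτ : τ ≠ 0) (x y z : Fin 3 → ℝ) {p : R4} (hp : p ∈ SL2) :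
    nabla τ (comb τ x) (nabla τ (comb τ y) (comb τ z)) p
      = comb τ (connection τ x (connection τ y z)) p := by
  have h := nabla_comb hτ (x := fun i _ => y i) (y := fun i _ => z i)
    (fun i => .const τ _) (fun i => .const τ _)
  change nabla τ (comb τ y) (comb τ z) = _ at h
  have h2 := congrFun (nabla_comb hτ (x := fun i _ => x i) (fun i => .const τ _)
    (fun i => .frameKoszul (x := fun i _ => y i) (y := fun i _ => z i)
    (fun i => .const τ _) (fun i => .const τ _) (Pi.single i 1))) p
  have hp' : pseudoInner p p = 1 := hp
  rw [← h] at h2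
  rw [hp'] at h2
  simpa only [frameKoszul_one hτ] using h2

theorem metric_comb_frame {τ : ℝ} (hτ : τ ≠ 0) (x : Fin 3 → ℝ) {p : R4} (hp : p ∈ SL2)
    (k : Fin 3) : metric τ p (comb τ x p) (frame τ k p) = x k := by
  have h : τ⁻¹ * τ = 1 := inv_mul_cancel₀ hτ
  have hw : hopfWeight τ 1 = 1 := by
    unfold hopfWeight; linear_combination (τ⁻¹ * τ + 1) * h
  have hp' : pseudoInner p p = 1 := hp
  rw [frame_eq_comb, metric_comb, hp']
  fin_cases k <;> simp [frameMetric, hw]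

theorem frameExt_comb {τ : ℝ} (hτ : τ ≠ 0) (x : Fin 3 → ℝ) {p : R4} (hp : p ∈ SL2) :
    frameExt τ p (comb τ x p) = comb τ x := by
  funext q
  simp only [frameExt, comb]
  exact Finset.sum_congr rfl fun k _ => by rw [← metric_comb_frame hτ x hp k]; rfl

theorem curvatureAt_comb {τ : ℝ} (hτ : τ ≠ 0) (x y z : Fin 3 → ℝ) {p : R4} (hp : p ∈ SL2) :
    curvatureAt τ p (comb τ x p) (comb τ y p) (comb τ z p)
      = comb τ (connection τ x (connection τ y z) - connection τ y (connection τ x z)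
          - connection τ (bracket τ x y) z) p := by
  have hb : VectorField.lieBracket ℝ (comb τ x) (comb τ y) = comb τ (bracket τ x y) :=
    funext fun q => lieBracket_comb hτ (x := fun i _ => x i) (y := fun i _ => y i)
      (fun i => .const τ _) (fun i => .const τ _) q
  rw [curvatureAt, frameExt_comb hτ x hp, frameExt_comb hτ y hp, frameExt_comb hτ z hp, curvature,
    hb, nabla_nabla_comb hτ _ _ _ hp, nabla_nabla_comb hτ _ _ _ hp, nabla_comb_const hτ _ _ hp]
  simp only [comb, Pi.sub_apply, sub_smul, Finset.sum_sub_distrib]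

/-- At a point of the quadric, `p, X₁, X₂, X₃` form a pseudo-orthonormal basis of `ℝ⁴₂`, so a vector
orthogonal to `p` is recovered from its frame components. -/
theorem comb_metric_frame {τ : ℝ} (hτ : τ ≠ 0) {p v : R4} (hp : p ∈ SL2)
    (hv : pseudoInner v p = 0) : v = comb τ (fun k => metric τ p v (frame τ k p)) p := by
  have h : τ⁻¹ * τ = 1 := inv_mul_cancel₀ hτ
  have hp' : p 0 * p 0 + p 1 * p 1 - p 2 * p 2 - p 3 * p 3 = 1 := hp
  have hv' : v 0 * p 0 + v 1 * p 1 - v 2 * p 2 - v 3 * p 3 = 0 := hv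
  have h0 : metric τ p v (frame τ 0 p) = -τ * pseudoInner v (X1 p) := by
    simp only [metric, frame, X1, pseudoInner, Matrix.cons_val, Pi.smul_apply, smul_eq_mul]
    linear_combination (-τ⁻¹ * (1 + τ ^ 2) * (-(v 0 * p 1) + v 1 * p 0 + v 2 * p 3 - v 3 * p 2)) * hp'
      + (-τ * (-(v 0 * p 1) + v 1 * p 0 + v 2 * p 3 - v 3 * p 2)) * h
  have h1 : metric τ p v (frame τ 1 p) = -pseudoInner v (X2 p) := by
    simp only [metric, frame, X1, X2, pseudoInner, Matrix.cons_val]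
    ring
  have h2 : metric τ p v (frame τ 2 p) = -pseudoInner v (X3 p) := by
    simp only [metric, frame, X1, X3, pseudoInner, Matrix.cons_val]
    ring
  simp only [comb, Fin.sum_univ_three, h0, h1, h2]
  have e : ∀ a : ℝ, (-τ * a) • frame τ 0 p = a • X1 p := fun a => by
    simp only [frame, Matrix.cons_val_zero, smul_smul]
    congr 1
    linear_combination a * h
  rw [e]
  ext j
  fin_cases j <;> simp [frame, X1, X2, X3, pseudoInner]
  · linear_combination -v 0 * hp' + p 0 * hv'
  · linear_combination -v 1 * hp' + p 1 * hv'
  · linear_combination -v 2 * hp' + p 2 * hv'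
  · linear_combination -v 3 * hp' + p 3 * hv'

theorem comb_eq_zero {τ : ℝ} (hτ : τ ≠ 0) {x : Fin 3 → ℝ} {p : R4} (hp : p ∈ SL2) :
    comb τ x p = 0 ↔ x = 0 := by
  refine ⟨fun h => funext fun k => ?_, fun h => by simp [h, comb]⟩
  rw [← metric_comb_frame hτ x hp k, h]
  simp [metric, pseudoInner]

/-! ### The biharmonic equation in components -/

/-- The components in the frame of the velocity of the curve `γ`. -/
def velocity (τ : ℝ) (γ : ℝ → R4) (s : ℝ) (k : Fin 3) : ℝ :=
  metric τ (γ s) (deriv γ s) (frame τ k (γ s))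

/-- The components of the covariant derivative of the field with the components `v` along a curve
whose velocity has the components `T`. -/
def covariant (τ : ℝ) (T v : ℝ → Fin 3 → ℝ) (s : ℝ) (k : Fin 3) : ℝ :=
  deriv (fun r => v r k) s + connection τ (T s) (v s) k

/-- The components of the curvature tensor. -/
def frameCurvature (τ : ℝ) (x y z : Fin 3 → ℝ) : Fin 3 → ℝ :=
  connection τ x (connection τ y z) - connection τ y (connection τ x z)
    - connection τ (bracket τ x y) z

section Curve

variable {τ : ℝ} {γ : ℝ → R4} {I : Set ℝ}

theorem deriv_eq_comb_velocity (hτ : τ ≠ 0) (hIo : IsOpen I) (hγ : ContDiffOn ℝ ∞ γ I)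
    (hSL : ∀ s ∈ I, γ s ∈ SL2) {s : ℝ} (hs : s ∈ I) :
    deriv γ s = comb τ (velocity τ γ s) (γ s) := by
  refine comb_metric_frame hτ (hSL s hs) ?_
  have hd : HasDerivAt γ (deriv γ s) s :=
    ((hγ.differentiableOn (by simp)).differentiableAt (hIo.mem_nhds hs)).hasDerivAt
  have hk := hasDerivAt_pi.1 hd
  have h : HasDerivAt (fun r => pseudoInner (γ r) (γ r)) _ s :=
    ((((hk 0).mul (hk 0)).add ((hk 1).mul (hk 1))).sub ((hk 2).mul (hk 2))).sub
      ((hk 3).mul (hk 3))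
  have h1 : (fun r => pseudoInner (γ r) (γ r)) =ᶠ[𝓝 s] fun _ => 1 := by
    filter_upwards [hIo.mem_nhds hs] with r hr using hSL r hr
  have h0 := h.unique ((hasDerivAt_const s (1 : ℝ)).congr_of_eventuallyEq h1)
  unfold pseudoInner
  linear_combination (1 / 2) * h0

theorem contDiffOn_velocity (hIo : IsOpen I) (hγ : ContDiffOn ℝ ∞ γ I) (k : Fin 3) :
    ContDiffOn ℝ ∞ (fun s => velocity τ γ s k) I := by
  have h := contDiffOn_pi.1 hγ
  have h' := contDiffOn_pi.1 (hγ.deriv_of_isOpen hIo (m := ∞) (by simp))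
  have e0 := h 0
  have e1 := h 1
  have e2 := h 2
  have e3 := h 3
  have d0 := h' 0
  have d1 := h' 1
  have d2 := h' 2
  have d3 := h' 3
  fin_cases k <;> simp [velocity, metric, pseudoInner, frame, X1, X2, X3] <;> fun_prop

theorem sum_velocity_sq (hτ : τ ≠ 0) (hIo : IsOpen I) (hγ : ContDiffOn ℝ ∞ γ I)
    (hSL : ∀ s ∈ I, γ s ∈ SL2) {s : ℝ} (hs : s ∈ I)
    (harc : metric τ (γ s) (deriv γ s) (deriv γ s) = 1) :
    velocity τ γ s 0 ^ 2 + velocity τ γ s 1 ^ 2 + velocity τ γ s 2 ^ 2 = 1 := by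
  have h : τ⁻¹ * τ = 1 := inv_mul_cancel₀ hτ
  have hp : pseudoInner (γ s) (γ s) = 1 := hSL s hs
  rw [deriv_eq_comb_velocity hτ hIo hγ hSL hs, metric_comb, hp, frameMetric, hopfWeight] at harc
  linear_combination harc - (τ⁻¹ * τ + 1) * velocity τ γ s 0 ^ 2 * h

theorem covDeriv_eq_comb (hτ : τ ≠ 0) (hIo : IsOpen I) (hγ : ContDiffOn ℝ ∞ γ I)
    (hSL : ∀ s ∈ I, γ s ∈ SL2) {V : ℝ → R4} {v : ℝ → Fin 3 → ℝ}
    (hV : ∀ s ∈ I, V s = comb τ (v s) (γ s)) {s : ℝ} (hs : s ∈ I) :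
    covDeriv τ γ V s = comb τ (covariant τ (velocity τ γ) v s) (γ s) := by
  have hp := hSL s hs
  have h1 : ∀ k, deriv (fun r => metric τ (γ r) (V r) (frame τ k (γ r))) s
      = deriv (fun r => v r k) s := fun k => by
    refine EventuallyEq.deriv_eq ?_
    filter_upwards [hIo.mem_nhds hs] with r hr
    rw [hV r hr, metric_comb_frame hτ _ (hSL r hr)]
  rw [covDeriv, hV s hs, deriv_eq_comb_velocity hτ hIo hγ hSL hs, frameExt_comb hτ _ hp,
    frameExt_comb hτ _ hp, nabla_comb_const hτ _ _ hp]
  simp only [h1, comb, covariant, add_smul, Finset.sum_add_distrib]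

theorem tension_eq_comb (hτ : τ ≠ 0) (hIo : IsOpen I) (hγ : ContDiffOn ℝ ∞ γ I)
    (hSL : ∀ s ∈ I, γ s ∈ SL2) {s : ℝ} (hs : s ∈ I) :
    tension τ γ s = comb τ (covariant τ (velocity τ γ) (velocity τ γ) s) (γ s) :=
  covDeriv_eq_comb hτ hIo hγ hSL (fun _ hr => deriv_eq_comb_velocity hτ hIo hγ hSL hr) hs

theorem bitension_eq_comb (hτ : τ ≠ 0) (hIo : IsOpen I) (hγ : ContDiffOn ℝ ∞ γ I)
    (hSL : ∀ s ∈ I, γ s ∈ SL2) {s : ℝ} (hs : s ∈ I) :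
    bitension τ γ s = comb τ (covariant τ (velocity τ γ) (covariant τ (velocity τ γ)
        (covariant τ (velocity τ γ) (velocity τ γ))) s
      - frameCurvature τ (velocity τ γ s) (covariant τ (velocity τ γ) (velocity τ γ) s)
        (velocity τ γ s)) (γ s) := by
  rw [bitension, covDeriv_eq_comb hτ hIo hγ hSL (fun r hr => covDeriv_eq_comb hτ hIo hγ hSL
    (fun r hr => tension_eq_comb hτ hIo hγ hSL hr) hr) hs, tension_eq_comb hτ hIo hγ hSL hs,
    deriv_eq_comb_velocity hτ hIo hγ hSL hs, curvatureAt_comb hτ _ _ _ (hSL s hs), frameCurvature]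
  simp only [comb, Pi.sub_apply, sub_smul, Finset.sum_sub_distrib]

theorem isProperBiharmonicOn_iff (hτ : τ ≠ 0) (hIo : IsOpen I) (hγ : ContDiffOn ℝ ∞ γ I)
    (hSL : ∀ s ∈ I, γ s ∈ SL2) :
    IsProperBiharmonicOn τ γ I ↔
      (∀ s ∈ I, covariant τ (velocity τ γ) (covariant τ (velocity τ γ)
        (covariant τ (velocity τ γ) (velocity τ γ))) s
          = frameCurvature τ (velocity τ γ s) (covariant τ (velocity τ γ) (velocity τ γ) s)
            (velocity τ γ s)) ∧
      ¬ ∀ s ∈ I, covariant τ (velocity τ γ) (velocity τ γ) s = 0 := by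
  refine and_congr (forall₂_congr fun s hs => ?_) (not_congr (forall₂_congr fun s hs => ?_))
  · rw [bitension_eq_comb hτ hIo hγ hSL hs, comb_eq_zero hτ (hSL s hs), sub_eq_zero]
  · rw [tension_eq_comb hτ hIo hγ hSL hs, comb_eq_zero hτ (hSL s hs)]

end Curve

theorem contDiffOn_covariant {τ : ℝ} {I : Set ℝ} (hIo : IsOpen I) {T v : ℝ → Fin 3 → ℝ}
    (hT : ∀ k, ContDiffOn ℝ ∞ (fun s => T s k) I) (hv : ∀ k, ContDiffOn ℝ ∞ (fun s => v s k) I)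
    (k : Fin 3) : ContDiffOn ℝ ∞ (fun s => covariant τ T v s k) I := by
  refine ((hv k).deriv_of_isOpen hIo (m := ∞) (by simp)).add ?_
  have a0 := hT 0
  have a1 := hT 1
  have a2 := hT 2
  have b0 := hv 0
  have b1 := hv 1
  have b2 := hv 2
  fin_cases k <;> simp [connection] <;> fun_prop

theorem hasDerivAt_of_covariant {τ : ℝ} {I : Set ℝ} (hIo : IsOpen I) {T v : ℝ → Fin 3 → ℝ}
    (hv : ∀ k, ContDiffOn ℝ ∞ (fun s => v s k) I) {s : ℝ} (hs : s ∈ I) (k : Fin 3) :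
    HasDerivAt (fun r => v r k) (covariant τ T v s k - connection τ (T s) (v s) k) s := by
  rw [covariant, add_sub_cancel_right]
  exact (((hv k).differentiableOn (by simp)).differentiableAt (hIo.mem_nhds hs)).hasDerivAt

theorem eq_of_hasDerivAt_zero {I : Set ℝ} (hIo : IsOpen I) (hIc : I.OrdConnected) {f : ℝ → ℝ}
    (hf : ∀ s ∈ I, HasDerivAt f 0 s) {x y : ℝ} (hx : x ∈ I) (hy : y ∈ I) : f x = f y :=
  hIo.is_const_of_deriv_eq_zero hIc.isPreconnected
    (fun s hs => (hf s hs).differentiableAt.differentiableWithinAt) (fun s hs => (hf s hs).deriv)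
    hx hy

theorem deriv_eq_zero_of_eqOn {I : Set ℝ} (hIo : IsOpen I) {f : ℝ → ℝ} {c f' s : ℝ}
    (hf : ∀ s ∈ I, f s = c) (hs : s ∈ I) (h : HasDerivAt f f' s) : f' = 0 :=
  h.unique ((hasDerivAt_const s c).congr_of_eventuallyEq
    (by filter_upwards [hIo.mem_nhds hs] with r hr using hf r hr))

/-! ### Vector algebra compatible with the connection -/

/-- The Euclidean inner product of components. -/
def dot (v w : Fin 3 → ℝ) : ℝ := v 0 * w 0 + v 1 * w 1 + v 2 * w 2

/-- The cross product of components. -/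
def cross (v w : Fin 3 → ℝ) : Fin 3 → ℝ :=
  ![v 1 * w 2 - v 2 * w 1, v 2 * w 0 - v 0 * w 2, v 0 * w 1 - v 1 * w 0]

/-- `v'` gives the components of the covariant derivative, at the parameter `s`, of a field with
the components `v` along a curve with the velocity components `t` at `s`. -/
def HasCovariantAt (τ : ℝ) (t : Fin 3 → ℝ) (v : ℝ → Fin 3 → ℝ) (v' : Fin 3 → ℝ) (s : ℝ) : Prop :=
  ∀ k, HasDerivAt (fun r => v r k) (v' k - connection τ t (v s) k) s

/-- Metric compatibility: `connection τ t` is skew, so its contributions cancel. -/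
theorem HasCovariantAt.dot {τ s : ℝ} {t v' w' : Fin 3 → ℝ} {v w : ℝ → Fin 3 → ℝ}
    (hv : HasCovariantAt τ t v v' s) (hw : HasCovariantAt τ t w w' s) :
    HasDerivAt (fun r => dot (v r) (w r)) (dot v' (w s) + dot (v s) w') s := by
  refine ((((hv 0).mul (hw 0)).add ((hv 1).mul (hw 1))).add ((hv 2).mul (hw 2))).congr_deriv ?_
  simp [SLBiharmonic.dot, connection]
  ring

/-- A skew map of `ℝ³` is a derivation of the cross product. -/
theorem HasCovariantAt.cross {τ s : ℝ} {t v' w' : Fin 3 → ℝ} {v w : ℝ → Fin 3 → ℝ}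
    (hv : HasCovariantAt τ t v v' s) (hw : HasCovariantAt τ t w w' s) :
    HasCovariantAt τ t (fun r => cross (v r) (w r)) (cross v' (w s) + cross (v s) w') s := by
  intro k
  fin_cases k
  · refine (((hv 1).mul (hw 2)).sub ((hv 2).mul (hw 1))).congr_deriv ?_
    simp [SLBiharmonic.cross, connection]
    ring
  · refine (((hv 2).mul (hw 0)).sub ((hv 0).mul (hw 2))).congr_deriv ?_
    simp [SLBiharmonic.cross, connection]
    ring
  · refine (((hv 0).mul (hw 1)).sub ((hv 1).mul (hw 0))).congr_deriv ?_
    simp [SLBiharmonic.cross, connection]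
    ring

/-- The curvature is `-τ² y` plus a correction along `E₁ × x`, with coefficient `4(1 + τ²) (x ×
y)₀`; the correction carries the anisotropy of the metric. -/
theorem frameCurvature_self {τ : ℝ} (hτ : τ ≠ 0) (x y : Fin 3 → ℝ) (hx : dot x x = 1)
    (hxy : dot x y = 0) :
    frameCurvature τ x y x
      = ![-τ ^ 2 * y 0, -τ ^ 2 * y 1 - 4 * (1 + τ ^ 2) * cross x y 0 * x 2,
        -τ ^ 2 * y 2 + 4 * (1 + τ ^ 2) * cross x y 0 * x 1] := by
  have h : τ⁻¹ * τ = 1 := inv_mul_cancel₀ hτ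
  unfold dot at hx hxy
  ext k
  fin_cases k
  · simp [frameCurvature, connection, bracket]
    linear_combination (-τ ^ 2 * y 0) * hx + τ ^ 2 * x 0 * hxy
  · simp [frameCurvature, connection, bracket, cross]
    linear_combination (-τ ^ 2 * y 1) * hx + τ ^ 2 * x 1 * hxy
      - 4 * (x 1 * y 2 - x 2 * y 1) * x 2 * h
  · simp [frameCurvature, connection, bracket, cross]
    linear_combination (-τ ^ 2 * y 2) * hx + τ ^ 2 * x 2 * hxy
      + 4 * (x 1 * y 2 - x 2 * y 1) * x 1 * h

theorem gram_expansion (t w y : Fin 3 → ℝ) (i : Fin 3) :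
    (dot t t * dot w w - dot t w ^ 2) * y i
      = (dot y t * dot w w - dot y w * dot t w) * t i
        + (dot y w * dot t t - dot y t * dot t w) * w i + dot y (cross t w) * cross t w i := by
  fin_cases i <;> simp [dot, cross] <;> ring

/-- The squared determinant of three vectors is their Gram determinant. -/
theorem gram_det (t w y : Fin 3 → ℝ) :
    dot y (cross t w) ^ 2 = dot y y * (dot t t * dot w w - dot t w ^ 2)
      - dot y t * (dot y t * dot w w - dot y w * dot t w)
      + dot y w * (dot y t * dot t w - dot y w * dot t t) := by
  simp [dot, cross]
  ring

theorem dot_comm (v w : Fin 3 → ℝ) : dot v w = dot w v := by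
  unfold dot; ring

/-! ### A proper biharmonic curve has constant Hopf angle -/

section Helix

variable {τ : ℝ} {I : Set ℝ} {T W Y : ℝ → Fin 3 → ℝ}

theorem exists_helix_constants (hτ : 0 < τ) (hIo : IsOpen I) (hIc : I.OrdConnected)
    (hI : ∀ s ∈ I, dot (T s) (T s) = 1)
    (hT : ∀ s ∈ I, HasCovariantAt τ (T s) T (W s) s)
    (hW : ∀ s ∈ I, HasCovariantAt τ (T s) W (Y s) s)
    (hY : ∀ s ∈ I, HasCovariantAt τ (T s) Y (frameCurvature τ (T s) (W s) (T s)) s)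
    (hne : ¬ ∀ s ∈ I, W s = 0) :
    ∃ C u : ℝ, C ^ 2 < 1 ∧ u ^ 2 - 2 * τ * u * C + 4 * (1 + τ ^ 2) * (1 - C ^ 2) = 0 ∧
      ∀ s ∈ I, T s 0 = C ∧ W s 1 = u * T s 2 ∧ W s 2 = -u * T s 1 := by
  have hτ0 : τ ≠ 0 := hτ.ne'
  have hTW : ∀ s ∈ I, dot (T s) (W s) = 0 := fun s hs => by
    have h := deriv_eq_zero_of_eqOn hIo hI hs ((hT s hs).dot (hT s hs))
    rw [dot_comm (W s)] at h
    linarith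
  have hTY : ∀ s ∈ I, dot (T s) (Y s) + dot (W s) (W s) = 0 := fun s hs => by
    have h := deriv_eq_zero_of_eqOn hIo hTW hs ((hT s hs).dot (hW s hs))
    linarith
  have hR : ∀ s ∈ I, ∀ v, dot v (frameCurvature τ (T s) (W s) (T s))
      = -τ ^ 2 * dot v (W s)
        + 4 * (1 + τ ^ 2) * cross (T s) (W s) 0 * (v 2 * T s 1 - v 1 * T s 2) := fun s hs v => by
    rw [frameCurvature_self hτ0 _ _ (hI s hs) (hTW s hs)]
    simp [dot]
    ring
  -- The derivative of `T·Y + W·W = 0` is `3 W·Y` plus `T·R(T, W)T`, and the curvature term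
  -- vanishes.
  have hWY : ∀ s ∈ I, dot (W s) (Y s) = 0 := fun s hs => by
    have h := deriv_eq_zero_of_eqOn hIo hTY hs
      (((hT s hs).dot (hY s hs)).add ((hW s hs).dot (hW s hs)))
    rw [hR s hs, hTW s hs, dot_comm (Y s)] at h
    linarith
  push Not at hne
  obtain ⟨s₀, hs₀, hW₀⟩ := hne
  obtain ⟨K, hK⟩ : ∃ K, K = dot (W s₀) (W s₀) := ⟨_, rfl⟩
  have hWW : ∀ s ∈ I, dot (W s) (W s) = K := fun s hs => by
    rw [hK]
    refine eq_of_hasDerivAt_zero hIo hIc (f := fun r => dot (W r) (W r)) (fun r hr => ?_) hs hs₀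
    refine ((hW r hr).dot (hW r hr)).congr_deriv ?_
    rw [dot_comm (Y r), hWY r hr, add_zero]
  have hKpos : 0 < K := by
    have h0 : 0 ≤ K := by rw [hK, dot]; nlinarith [sq_nonneg (W s₀ 0), sq_nonneg (W s₀ 1), sq_nonneg (W s₀ 2)]
    refine lt_of_le_of_ne h0 fun h => hW₀ ?_
    rw [hK] at h
    unfold dot at h
    ext k
    fin_cases k <;> simp <;> nlinarith [sq_nonneg (W s₀ 0), sq_nonneg (W s₀ 1), sq_nonneg (W s₀ 2)]
  have hYY : ∀ s ∈ I, dot (Y s) (Y s)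
      = τ ^ 2 * K - 4 * (1 + τ ^ 2) * cross (T s) (W s) 0 ^ 2 := fun s hs => by
    have h := deriv_eq_zero_of_eqOn hIo hWY hs ((hW s hs).dot (hY s hs))
    rw [hR s hs, hWW s hs] at h
    simp only [cross, Matrix.cons_val_zero] at h ⊢
    linear_combination h
  obtain ⟨B, hB⟩ : ∃ B : ℝ → Fin 3 → ℝ, B = fun r => cross (T r) (W r) := ⟨_, rfl⟩
  have hBs : ∀ r, cross (T r) (W r) = B r := fun r => by rw [hB]
  -- `m / K` is the torsion, up to the sign convention.
  obtain ⟨m, hm⟩ : ∃ m : ℝ → ℝ, m = fun r => dot (Y r) (B r) := ⟨_, rfl⟩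
  have hms : ∀ r, dot (Y r) (B r) = m r := fun r => by rw [hm]
  have hexp : ∀ s ∈ I, ∀ i, K * Y s i = -K ^ 2 * T s i + m s * B s i := fun s hs i => by
    have h := gram_expansion (T s) (W s) (Y s) i
    rw [hI s hs, hTW s hs, hWW s hs, dot_comm (Y s) (W s), hWY s hs, dot_comm (Y s) (T s),
      hBs, hms] at h
    have h1 := hTY s hs
    rw [hWW s hs] at h1
    linear_combination h + K * T s i * h1
  have hdet : ∀ s ∈ I, m s ^ 2 = τ ^ 2 * K ^ 2 - 4 * (1 + τ ^ 2) * K * B s 0 ^ 2 - K ^ 3 :=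
    fun s hs => by
    have h := gram_det (T s) (W s) (Y s)
    rw [hI s hs, hTW s hs, hWW s hs, dot_comm (Y s) (W s), hWY s hs, dot_comm (Y s) (T s),
      hYY s hs, hBs, hms] at h
    have h1 := hTY s hs
    rw [hWW s hs] at h1
    linear_combination h + K * (K - dot (T s) (Y s)) * h1
  have hBcov : ∀ s ∈ I, HasCovariantAt τ (T s) B (cross (T s) (Y s)) s := fun s hs => by
    have h := (hT s hs).cross (hW s hs)
    rw [hB]
    convert h using 1
    ext k
    fin_cases k <;> simp [cross] <;> ring
  have hmd : ∀ s ∈ I, HasDerivAt m (-4 * (1 + τ ^ 2) * B s 0 * W s 0) s := fun s hs => by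
    rw [hm]
    refine ((hY s hs).dot (hBcov s hs)).congr_deriv ?_
    have h1 : dot (B s) (W s) = 0 := by
      rw [← hBs]; simp [dot, cross]; ring
    have h2 : dot (Y s) (cross (T s) (Y s)) = 0 := by
      simp [dot, cross]; ring
    have h3 : B s 2 * T s 1 - B s 1 * T s 2
        = T s 0 * dot (T s) (W s) - W s 0 * dot (T s) (T s) := by
      rw [← hBs]; simp [dot, cross]; ring
    rw [dot_comm, hR s hs, hBs, h1, h2, h3, hTW s hs, hI s hs]
    ring
  have hBd : ∀ s ∈ I, HasDerivAt (fun r => B r 0) ((τ - m s / K) * W s 0) s := fun s hs => by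
    refine (hBcov s hs 0).congr_deriv ?_
    have h1 := hexp s hs 1
    have h2 := hexp s hs 2
    have h3 : T s 1 * B s 2 - T s 2 * B s 1
        = T s 0 * dot (T s) (W s) - W s 0 * dot (T s) (T s) := by
      rw [← hBs]; simp [dot, cross]; ring
    rw [hTW s hs, hI s hs] at h3
    simp only [cross, connection, Matrix.cons_val_zero]
    field_simp
    linear_combination T s 1 * h2 - T s 2 * h1 + (m s - K * τ) * h3
  have hτ2 : (1 + τ ^ 2) ≠ 0 := by positivity
  -- Differentiate the Gram relation `hdet` and insert `m'` and `B₀'`.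
  have hprod : ∀ s ∈ I, B s 0 * W s 0 * (2 * m s - τ * K) = 0 := fun s hs => by
    have h := deriv_eq_zero_of_eqOn hIo (f := fun r => m r ^ 2 + 4 * (1 + τ ^ 2) * K * B r 0 ^ 2)
      (c := τ ^ 2 * K ^ 2 - K ^ 3) (fun r hr => by have := hdet r hr; linarith) hs
      (((hmd s hs).pow 2).add (((hBd s hs).pow 2).const_mul (4 * (1 + τ ^ 2) * K)))
    have h5 : K * (m s / K) = m s := by field_simp
    simp only [Nat.cast_ofNat, Nat.add_one_sub_one, pow_one] at h
    have h4 : 8 * (1 + τ ^ 2) * (B s 0 * W s 0 * (2 * m s - τ * K)) = 0 := by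
      linear_combination -h - 8 * (1 + τ ^ 2) * B s 0 * W s 0 * h5
    simpa [hτ2] using h4
  -- Where the product is nonzero, `m = τK/2` on a neighbourhood, so `m' = 0`; but `m'` is a nonzero
  -- multiple of the product.
  have hBW : ∀ s ∈ I, B s 0 * W s 0 = 0 := fun s hs => by
    by_contra hc
    have hcont : ContinuousAt (fun r => B r 0 * W r 0) s :=
      (hBd s hs).continuousAt.mul (hW s hs 0).continuousAt
    have hev : m =ᶠ[𝓝 s] fun _ => τ * K / 2 := by
      filter_upwards [hcont.eventually_ne hc, hIo.mem_nhds hs] with r hr hrI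
      have := (mul_eq_zero.1 (hprod r hrI)).resolve_left hr
      linarith
    have h0 := (hmd s hs).unique ((hasDerivAt_const s _).congr_of_eventuallyEq hev)
    have h4 : (-4 * (1 + τ ^ 2)) * (B s 0 * W s 0) = 0 := by linear_combination h0
    rcases mul_eq_zero.1 h4 with h | h
    · exact hτ2 (by linarith)
    · exact hc h
  have hmc : ∀ s ∈ I, ∀ r ∈ I, m s = m r := fun s hs r hr =>
    eq_of_hasDerivAt_zero hIo hIc (fun r hr => (hmd r hr).congr_deriv (by
      linear_combination (-4 * (1 + τ ^ 2)) * hBW r hr)) hs hr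
  -- If `W₀ ≠ 0` somewhere, then `B₀ = 0` there, and on all of `I` since `m` is constant. Then `B₀'
  -- = 0` gives `m = τK`, and `hdet` gives `K = 0`.
  have hW0 : ∀ s ∈ I, W s 0 = 0 := fun s hs => by
    by_contra hc
    have hBs0 : B s 0 = 0 := (mul_eq_zero.1 (hBW s hs)).resolve_right hc
    have hB0 : ∀ r ∈ I, B r 0 = 0 := fun r hr => by
      have h1 := hdet s hs
      have h2 := hdet r hr
      rw [hmc s hs r hr, h2, hBs0] at h1
      have h3 : (4 * (1 + τ ^ 2) * K) * B r 0 ^ 2 = 0 := by linear_combination -h1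
      have h4 : 4 * (1 + τ ^ 2) * K ≠ 0 := by positivity
      exact pow_eq_zero_iff (two_ne_zero) |>.1 ((mul_eq_zero.1 h3).resolve_left h4)
    have h1 := (mul_eq_zero.1 (deriv_eq_zero_of_eqOn hIo hB0 hs (hBd s hs))).resolve_right hc
    have h2 : m s = τ * K := by field_simp at h1; linarith
    have h3 := hdet s hs
    rw [h2, hBs0] at h3
    have : K ^ 3 = 0 := by linear_combination h3
    exact hKpos.ne' (pow_eq_zero_iff (three_ne_zero) |>.1 this)
  have hTc : ∀ s ∈ I, T s 0 = T s₀ 0 := fun s hs =>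
    eq_of_hasDerivAt_zero hIo hIc (f := fun r => T r 0) (fun r hr => (hT r hr 0).congr_deriv (by
      rw [hW0 r hr]; simp [connection, mul_comm])) hs hs₀
  have hBc : ∀ s ∈ I, B s 0 = B s₀ 0 := fun s hs =>
    eq_of_hasDerivAt_zero hIo hIc (f := fun r => B r 0) (fun r hr => (hBd r hr).congr_deriv (by
      rw [hW0 r hr, mul_zero])) hs hs₀
  obtain ⟨C, hC⟩ : ∃ C, C = T s₀ 0 := ⟨_, rfl⟩
  rw [← hC] at hTc
  obtain ⟨S, hS⟩ : ∃ S, S = 1 - C ^ 2 := ⟨_, rfl⟩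
  have hTS : ∀ s ∈ I, T s 1 ^ 2 + T s 2 ^ 2 = S := fun s hs => by
    have h := hI s hs
    rw [dot, hTc s hs] at h
    linear_combination h - hS
  have hTW' : ∀ s ∈ I, T s 1 * W s 1 + T s 2 * W s 2 = 0 := fun s hs => by
    have h := hTW s hs
    rw [dot, hW0 s hs] at h
    linear_combination h
  -- For `S = 0` the curve is an integral curve of `±E₁`, a geodesic.
  have hSpos : 0 < S := by
    have h0 : 0 ≤ S := by rw [← hTS s₀ hs₀]; positivity
    refine lt_of_le_of_ne h0 fun h => hW₀ ?_
    have t1 : ∀ s ∈ I, T s 1 = 0 := fun s hs => by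
      have := hTS s hs
      nlinarith [sq_nonneg (T s 1), sq_nonneg (T s 2)]
    have t2 : ∀ s ∈ I, T s 2 = 0 := fun s hs => by
      have := hTS s hs
      nlinarith [sq_nonneg (T s 1), sq_nonneg (T s 2)]
    have d1 := deriv_eq_zero_of_eqOn hIo t1 hs₀ (hT s₀ hs₀ 1)
    have d2 := deriv_eq_zero_of_eqOn hIo t2 hs₀ (hT s₀ hs₀ 2)
    simp [connection, t1 s₀ hs₀, t2 s₀ hs₀] at d1 d2
    ext k
    fin_cases k
    · exact hW0 s₀ hs₀
    · exact d1
    · exact d2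
  have hSne := hSpos.ne'
  have hB0 : ∀ s ∈ I, T s 1 * W s 2 - T s 2 * W s 1 = B s₀ 0 := fun s hs => by
    rw [← hBc s hs, ← hBs]; simp [cross]
  -- `W` is orthogonal to `T` and to `E₁`, and `B₀` is constant, so `W = u (0, T₂, -T₁)` with this
  -- `u`.
  obtain ⟨u, hu⟩ : ∃ u, B s₀ 0 = -u * S := ⟨-B s₀ 0 / S, by field_simp⟩
  have hW1 : ∀ s ∈ I, W s 1 = u * T s 2 := fun s hs => by
    refine mul_left_cancel₀ hSne ?_
    linear_combination T s 1 * hTW' s hs - T s 2 * hB0 s hs - T s 2 * hu - W s 1 * hTS s hs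
  have hW2 : ∀ s ∈ I, W s 2 = -u * T s 1 := fun s hs => by
    refine mul_left_cancel₀ hSne ?_
    linear_combination T s 2 * hTW' s hs + T s 1 * hB0 s hs + T s 1 * hu - W s 2 * hTS s hs
  refine ⟨C, u, by linarith, ?_, fun s hs => ⟨hTc s hs, hW1 s hs, hW2 s hs⟩⟩
  have hKu : K = u ^ 2 * S := by
    rw [← hWW s₀ hs₀, dot, hW0 s₀ hs₀, hW1 s₀ hs₀, hW2 s₀ hs₀, ← hTS s₀ hs₀]; ring
  have hune : u ≠ 0 := fun h => by rw [h] at hKu; simp at hKu; exact hKpos.ne' hKu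
  have hY0 := deriv_eq_zero_of_eqOn hIo hW0 hs₀ (hW s₀ hs₀ 0)
  simp only [connection, Matrix.cons_val_zero] at hY0
  have hB0' := hB0 s₀ hs₀
  have he := hexp s₀ hs₀ 0
  have hd := hdet s₀ hs₀
  rw [← hC, hu] at he
  rw [hu] at hd
  rw [hu] at hB0'
  -- From the `E₁` component of the expansion of `Y`, where `W₀ = 0` gives `Y₀ = τ B₀`. Inserted in
  -- `hdet` and divided by `u⁴ S²`, it gives the quadratic.
  have hm1 : m s₀ = τ * (u ^ 2 * S) - u ^ 3 * S * C := by
    refine mul_left_cancel₀ (mul_ne_zero hune hSne) ?_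
    rw [hKu] at he
    linear_combination he - (u ^ 2 * S) * hY0 - u ^ 2 * S * τ * hB0'
  rw [hm1, hKu] at hd
  rw [← hS]
  refine mul_left_cancel₀ (mul_ne_zero (pow_ne_zero 4 hune) (pow_ne_zero 2 hSne)) ?_
  linear_combination hd - u ^ 6 * S ^ 2 * hS

end Helix

/-! ### Helices and the biharmonic equation -/

theorem covariant_eq {τ s : ℝ} {I : Set ℝ} (hIo : IsOpen I) (hs : s ∈ I)
    {T v w : ℝ → Fin 3 → ℝ} {v' : Fin 3 → ℝ} (hv : ∀ r ∈ I, v r = w r)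
    (hw : HasCovariantAt τ (T s) w v' s) : covariant τ T v s = v' := by
  ext k
  have h : (fun r => v r k) =ᶠ[𝓝 s] fun r => w r k := by
    filter_upwards [hIo.mem_nhds hs] with r hr
    rw [hv r hr]
  rw [covariant, h.deriv_eq, (hw k).deriv, hv s hs, sub_add_cancel]

/-- The components `T` make a constant angle with cosine `C` with the first axis and turn about it
with angular velocity `f`. -/
structure IsHelixOn (T : ℝ → Fin 3 → ℝ) (I : Set ℝ) (C : ℝ) (f : ℝ → ℝ) : Prop where
  fst : ∀ s ∈ I, T s 0 = C
  sq : ∀ s ∈ I, T s 1 ^ 2 + T s 2 ^ 2 = 1 - C ^ 2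
  deriv_one : ∀ s ∈ I, HasDerivAt (fun r => T r 1) (f s * T s 2) s
  deriv_two : ∀ s ∈ I, HasDerivAt (fun r => T r 2) (-f s * T s 1) s

namespace IsHelixOn

variable {τ C b : ℝ} {f f₁ f₂ : ℝ → ℝ} {T : ℝ → Fin 3 → ℝ} {I : Set ℝ}

theorem deriv_zero (h : IsHelixOn T I C f) (hIo : IsOpen I) {s : ℝ} (hs : s ∈ I) :
    HasDerivAt (fun r => T r 0) 0 s :=
  (hasDerivAt_const s C).congr_of_eventuallyEq
    (by filter_upwards [hIo.mem_nhds hs] with r hr using h.fst r hr)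

theorem covariant_self (h : IsHelixOn T I C fun _ => b) (hIo : IsOpen I) {s : ℝ}
    (hs : s ∈ I) : covariant τ T T s
      = ![0, (b + (2 * τ + 2 * τ⁻¹) * C) * T s 2, -(b + (2 * τ + 2 * τ⁻¹) * C) * T s 1] := by
  refine covariant_eq hIo hs (fun _ _ => rfl) fun k => ?_
  have h0 := h.fst s hs
  fin_cases k
  · refine (h.deriv_zero hIo hs).congr_deriv ?_
    simp [connection, mul_comm]
  · refine (h.deriv_one s hs).congr_deriv ?_
    simp [connection, h0]
    ring
  · refine (h.deriv_two s hs).congr_deriv ?_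
    simp [connection, h0]
    ring

theorem covariant_covariant (h : IsHelixOn T I C fun _ => b) (hIo : IsOpen I) {s : ℝ}
    (hs : s ∈ I) : covariant τ T (covariant τ T T) s
      = ![-τ * (b + (2 * τ + 2 * τ⁻¹) * C) * (1 - C ^ 2),
          -(b + (2 * τ + 2 * τ⁻¹) * C) * (b + (τ + 2 * τ⁻¹) * C) * T s 1,
          -(b + (2 * τ + 2 * τ⁻¹) * C) * (b + (τ + 2 * τ⁻¹) * C) * T s 2] := by
  refine covariant_eq hIo hs (fun r hr => h.covariant_self hIo hr) fun k => ?_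
  have h0 := h.fst s hs
  have h1 := h.sq s hs
  fin_cases k
  · refine (hasDerivAt_const s (0 : ℝ)).congr_deriv ?_
    simp [connection]
    linear_combination -τ * (b + (2 * τ + 2 * τ⁻¹) * C) * h1
  · refine ((h.deriv_two s hs).const_mul _).congr_deriv ?_
    simp [connection, h0]
    ring
  · refine ((h.deriv_one s hs).const_mul _).congr_deriv ?_
    simp [connection, h0]
    ring

/-- Only the components orthogonal to `E₁` impose a condition, and there both sides differ by `u`
times the quadratic `hb`, where `u = b + (2τ + 2τ⁻¹) C`. -/
theorem biharmonic (h : IsHelixOn T I C fun _ => b) (hIo : IsOpen I) (hτ : τ ≠ 0)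
    (hb : (b + (2 * τ + 2 * τ⁻¹) * C) ^ 2 - 2 * τ * (b + (2 * τ + 2 * τ⁻¹) * C) * C
      + 4 * (1 + τ ^ 2) * (1 - C ^ 2) = 0) {s : ℝ} (hs : s ∈ I) :
    covariant τ T (covariant τ T (covariant τ T T)) s
      = frameCurvature τ (T s) (covariant τ T T s) (T s) := by
  have h0 := h.fst s hs
  have h1 := h.sq s hs
  rw [h.covariant_self hIo hs, frameCurvature_self hτ _ _
    (by simp [dot, h0]; linear_combination h1) (by simp [dot]; ring)]
  obtain ⟨u, hu⟩ : ∃ u, u = b + (2 * τ + 2 * τ⁻¹) * C := ⟨_, rfl⟩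
  have hg : b + (τ + 2 * τ⁻¹) * C = u - τ * C := by rw [hu]; ring
  have hb' : b = u - (2 * τ + 2 * τ⁻¹) * C := by rw [hu]; ring
  refine covariant_eq hIo hs (fun r hr => h.covariant_covariant hIo hr) fun k => ?_
  simp only [← hu, hg] at hb ⊢
  fin_cases k
  · refine (hasDerivAt_const s _).congr_deriv ?_
    simp only [connection, Matrix.cons_val, Fin.zero_eta]
    ring
  · refine ((h.deriv_one s hs).const_mul _).congr_deriv ?_
    simp [connection, cross, h0]
    rw [hb']
    linear_combination (-u * T s 2) * hb - 4 * (1 + τ ^ 2) * u * T s 2 * h1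
  · refine ((h.deriv_two s hs).const_mul _).congr_deriv ?_
    simp [connection, cross, h0]
    rw [hb']
    linear_combination (u * T s 1) * hb + 4 * (1 + τ ^ 2) * u * T s 1 * h1

end IsHelixOn

/-! ### Derivatives in the ambient space -/

theorem pseudoInner_comb_self (τ : ℝ) (x : Fin 3 → ℝ) (p : R4) : pseudoInner (comb τ x p) p = 0 := by
  simp [comb, Fin.sum_univ_three, frame, X1, X2, X3, pseudoInner]
  ring

theorem smul_add_comb_eq_zero {τ : ℝ} (hτ : τ ≠ 0) {α : ℝ} {x : Fin 3 → ℝ} {p : R4}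
    (hp : p ∈ SL2) : α • p + comb τ x p = 0 ↔ α = 0 ∧ x = 0 := by
  refine ⟨fun h => ?_, fun h => by simp [h.1, h.2, comb]⟩
  have h1 : pseudoInner (α • p + comb τ x p) p
      = α * pseudoInner p p + pseudoInner (comb τ x p) p := by
    simp [pseudoInner]; ring
  have hp' : pseudoInner p p = 1 := hp
  rw [h, pseudoInner_comb_self, hp'] at h1
  have hα : α = 0 := by simpa [pseudoInner] using h1.symm
  rw [hα, zero_smul, zero_add, comb_eq_zero hτ hp] at h
  exact ⟨hα, h⟩

/-- The chain rule produces products of two frame maps, which are multiples of the identity (`E₁² =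
-τ⁻²`, `E₂² = E₃² = 1`) or of the third frame map, as for split quaternions. -/
theorem hasDerivAt_smul_add_comb {τ : ℝ} (hτ : τ ≠ 0) {γ : ℝ → R4} {s : ℝ} {T : Fin 3 → ℝ}
    (hγ : HasDerivAt γ (comb τ T (γ s)) s) {α : ℝ → ℝ} {α' : ℝ} (hα : HasDerivAt α α' s)
    {v : ℝ → Fin 3 → ℝ} {v' : Fin 3 → ℝ} (hv : ∀ k, HasDerivAt (fun r => v r k) (v' k) s) :
    HasDerivAt (fun r => α r • γ r + comb τ (v r) (γ r))
      ((α' - (τ ^ 2)⁻¹ * (v s 0 * T 0) + v s 1 * T 1 + v s 2 * T 2) • γ s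
        + comb τ ![α s * T 0 + v' 0 + τ * (T 1 * v s 2 - T 2 * v s 1),
          α s * T 1 + v' 1 - τ⁻¹ * (T 2 * v s 0 - T 0 * v s 2),
          α s * T 2 + v' 2 - τ⁻¹ * (T 0 * v s 1 - T 1 * v s 0)] (γ s)) s := by
  have hE : ∀ k, HasDerivAt (fun r => frame τ k (γ r)) (frame τ k (comb τ T (γ s))) s := fun k =>
    (hasFDerivAt_frame τ k (γ s)).comp_hasDerivAt s hγ
  unfold comb at hγ hE ⊢
  refine ((hα.smul hγ).add (HasDerivAt.fun_sum fun k _ => (hv k).smul (hE k))).congr_deriv ?_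
  simp only [Fin.sum_univ_three]
  ext j
  fin_cases j <;> simp [frame, X1, X2, X3, Matrix.vecHead, Matrix.vecTail] <;> field_simp <;> ring

namespace IsHelixOn

variable {τ C : ℝ} {f f₁ f₂ : ℝ → ℝ} {γ : ℝ → R4} {T : ℝ → Fin 3 → ℝ} {I : Set ℝ}

theorem iteratedDeriv_two (hτ : τ ≠ 0) (hIo : IsOpen I) (h : IsHelixOn T I C f)
    (hγ : ∀ s ∈ I, HasDerivAt γ (comb τ (T s) (γ s)) s) {s : ℝ} (hs : s ∈ I) :
    iteratedDeriv 2 γ s = (1 - C ^ 2 - (τ⁻¹ * C) ^ 2) • γ s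
      + comb τ ![0, f s * T s 2, -f s * T s 1] (γ s) := by
  have h1 : iteratedDeriv 1 γ =ᶠ[𝓝 s] fun r => (0 : ℝ) • γ r + comb τ (T r) (γ r) := by
    filter_upwards [hIo.mem_nhds hs] with r hr
    rw [iteratedDeriv_one, (hγ r hr).deriv]
    simp
  rw [iteratedDeriv_succ, h1.deriv_eq, (hasDerivAt_smul_add_comb hτ (hγ s hs)
    (hasDerivAt_const s (0 : ℝ)) (v' := ![0, f s * T s 2, -f s * T s 1]) ?_).deriv]
  · have h0 := h.fst s hs
    have h2 := h.sq s hs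
    refine congrArg₂ (fun (a : ℝ) (x : Fin 3 → ℝ) => a • γ s + comb τ x (γ s)) ?_ (funext fun k => ?_)
    · rw [h0]; linear_combination h2
    · fin_cases k <;> simp [mul_comm]
  · intro k
    fin_cases k
    · exact h.deriv_zero hIo hs
    · exact h.deriv_one s hs
    · exact h.deriv_two s hs

theorem iteratedDeriv_three (hτ : τ ≠ 0) (hIo : IsOpen I) (h : IsHelixOn T I C f)
    (hf : ∀ s ∈ I, HasDerivAt f (f₁ s) s)
    (hγ : ∀ s ∈ I, HasDerivAt γ (comb τ (T s) (γ s)) s) {s : ℝ} (hs : s ∈ I) :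
    iteratedDeriv 3 γ s = (0 : ℝ) • γ s
      + comb τ ![(1 - C ^ 2 - (τ⁻¹ * C) ^ 2) * C - τ * f s * (1 - C ^ 2),
          (1 - C ^ 2 - (τ⁻¹ * C) ^ 2 - f s ^ 2 - τ⁻¹ * C * f s) * T s 1 + f₁ s * T s 2,
          (1 - C ^ 2 - (τ⁻¹ * C) ^ 2 - f s ^ 2 - τ⁻¹ * C * f s) * T s 2 - f₁ s * T s 1] (γ s) := by
  have h1 : iteratedDeriv 2 γ =ᶠ[𝓝 s] fun r => (1 - C ^ 2 - (τ⁻¹ * C) ^ 2) • γ r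
      + comb τ ![0, f r * T r 2, -f r * T r 1] (γ r) := by
    filter_upwards [hIo.mem_nhds hs] with r hr using h.iteratedDeriv_two hτ hIo hγ hr
  rw [iteratedDeriv_succ, h1.deriv_eq, (hasDerivAt_smul_add_comb hτ (hγ s hs)
    (hasDerivAt_const s _) (v' := ![0, f₁ s * T s 2 + f s * (-f s * T s 1),
      -f₁ s * T s 1 + -f s * (f s * T s 2)]) ?_).deriv]
  · have h0 := h.fst s hs
    have h2 := h.sq s hs
    refine congrArg₂ (fun (a : ℝ) (x : Fin 3 → ℝ) => a • γ s + comb τ x (γ s)) ?_ (funext fun k => ?_)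
    · simp; ring
    · fin_cases k <;> simp [h0]
      · linear_combination -τ * f s * h2
      · ring
      · ring
  · intro k
    fin_cases k
    · exact hasDerivAt_const s _
    · exact (hf s hs).mul (h.deriv_two s hs)
    · exact (hf s hs).neg.mul (h.deriv_one s hs)

theorem iteratedDeriv_four (hτ : τ ≠ 0) (hIo : IsOpen I) (h : IsHelixOn T I C f)
    (hf : ∀ s ∈ I, HasDerivAt f (f₁ s) s) (hf₁ : ∀ s ∈ I, HasDerivAt f₁ (f₂ s) s)
    (hγ : ∀ s ∈ I, HasDerivAt γ (comb τ (T s) (γ s)) s) {s : ℝ} (hs : s ∈ I) :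
    iteratedDeriv 4 γ s = ((1 - C ^ 2 - (τ⁻¹ * C) ^ 2) ^ 2 - f s ^ 2 * (1 - C ^ 2)) • γ s
      + comb τ ![-2 * τ * (1 - C ^ 2) * f₁ s,
          -(3 * f s + 2 * τ⁻¹ * C) * f₁ s * T s 1
            + (f s * (2 * (1 - C ^ 2) - (τ⁻¹ * C) ^ 2 - (f s + τ⁻¹ * C) ^ 2) + f₂ s) * T s 2,
          -(3 * f s + 2 * τ⁻¹ * C) * f₁ s * T s 2
            - (f s * (2 * (1 - C ^ 2) - (τ⁻¹ * C) ^ 2 - (f s + τ⁻¹ * C) ^ 2) + f₂ s) * T s 1]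
          (γ s) := by
  have h1 : iteratedDeriv 3 γ =ᶠ[𝓝 s] fun r => (0 : ℝ) • γ r
      + comb τ ![(1 - C ^ 2 - (τ⁻¹ * C) ^ 2) * C - τ * f r * (1 - C ^ 2),
          (1 - C ^ 2 - (τ⁻¹ * C) ^ 2 - f r ^ 2 - τ⁻¹ * C * f r) * T r 1 + f₁ r * T r 2,
          (1 - C ^ 2 - (τ⁻¹ * C) ^ 2 - f r ^ 2 - τ⁻¹ * C * f r) * T r 2 - f₁ r * T r 1] (γ r) := by
    filter_upwards [hIo.mem_nhds hs] with r hr using h.iteratedDeriv_three hτ hIo hf hγ hr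
  have hq : HasDerivAt (fun r => 1 - C ^ 2 - (τ⁻¹ * C) ^ 2 - f r ^ 2 - τ⁻¹ * C * f r)
      (-(2 * f s + τ⁻¹ * C) * f₁ s) s :=
    ((((hf s hs).pow 2).const_sub _).sub ((hf s hs).const_mul _)).congr_deriv (by simp; ring)
  rw [iteratedDeriv_succ, h1.deriv_eq, (hasDerivAt_smul_add_comb hτ (hγ s hs)
    (hasDerivAt_const s (0 : ℝ)) (v' := ![-(τ * f₁ s * (1 - C ^ 2)),
      (-(2 * f s + τ⁻¹ * C) * f₁ s) * T s 1
        + (1 - C ^ 2 - (τ⁻¹ * C) ^ 2 - f s ^ 2 - τ⁻¹ * C * f s) * (f s * T s 2)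
        + (f₂ s * T s 2 + f₁ s * (-f s * T s 1)),
      (-(2 * f s + τ⁻¹ * C) * f₁ s) * T s 2
        + (1 - C ^ 2 - (τ⁻¹ * C) ^ 2 - f s ^ 2 - τ⁻¹ * C * f s) * (-f s * T s 1)
        - (f₂ s * T s 1 + f₁ s * (f s * T s 2))]) ?_).deriv]
  · have h0 := h.fst s hs
    have h2 := h.sq s hs
    have ht : τ⁻¹ * τ = 1 := inv_mul_cancel₀ hτ
    refine congrArg₂ (fun (a : ℝ) (x : Fin 3 → ℝ) => a • γ s + comb τ x (γ s)) ?_ (funext fun k => ?_)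
    · simp [h0]
      linear_combination (1 - C ^ 2 - (τ⁻¹ * C) ^ 2 - f s ^ 2 - τ⁻¹ * C * f s) * h2
        + τ⁻¹ * C * f s * (1 - C ^ 2) * ht
    · fin_cases k <;> simp [h0]
      · linear_combination -τ * f₁ s * h2
      · linear_combination T s 2 * f s * (1 - C ^ 2) * ht
      · linear_combination -T s 1 * f s * (1 - C ^ 2) * ht
  · intro k
    fin_cases k
    · exact (((hf s hs).const_mul τ).mul_const _).const_sub _
    · exact (hq.mul (h.deriv_one s hs)).add ((hf₁ s hs).mul (h.deriv_two s hs))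
    · exact (hq.mul (h.deriv_two s hs)).sub ((hf₁ s hs).mul (h.deriv_one s hs))

/-- The fourth order equation for a helix, in terms of its angular velocity. -/
theorem fourth_order_iff (hτ : τ ≠ 0) (hIo : IsOpen I) (h : IsHelixOn T I C f)
    (hf : ∀ s ∈ I, HasDerivAt f (f₁ s) s) (hf₁ : ∀ s ∈ I, HasDerivAt f₁ (f₂ s) s)
    (hγ : ∀ s ∈ I, HasDerivAt γ (comb τ (T s) (γ s)) s) (hSL : ∀ s ∈ I, γ s ∈ SL2)
    (hC : C ^ 2 < 1) (P Q : ℝ) {s : ℝ} (hs : s ∈ I) :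
    iteratedDeriv 4 γ s + P • iteratedDeriv 2 γ s + Q • γ s = 0 ↔
      f₁ s = 0 ∧ (1 - C ^ 2 - (τ⁻¹ * C) ^ 2) ^ 2 - f s ^ 2 * (1 - C ^ 2)
          + P * (1 - C ^ 2 - (τ⁻¹ * C) ^ 2) + Q = 0 ∧
        f s * (2 * (1 - C ^ 2) - (τ⁻¹ * C) ^ 2 - (f s + τ⁻¹ * C) ^ 2 + P) + f₂ s = 0 := by
  obtain ⟨q, hq⟩ : ∃ q, q = (1 - C ^ 2 - (τ⁻¹ * C) ^ 2) ^ 2 - f s ^ 2 * (1 - C ^ 2)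
          + P * (1 - C ^ 2 - (τ⁻¹ * C) ^ 2) + Q := ⟨_, rfl⟩
  obtain ⟨N, hN⟩ : ∃ N, N = f s * (2 * (1 - C ^ 2) - (τ⁻¹ * C) ^ 2 - (f s + τ⁻¹ * C) ^ 2 + P)
    + f₂ s := ⟨_, rfl⟩
  have key : iteratedDeriv 4 γ s + P • iteratedDeriv 2 γ s + Q • γ s
      = q • γ s + comb τ ![-2 * τ * (1 - C ^ 2) * f₁ s,
          -(3 * f s + 2 * τ⁻¹ * C) * f₁ s * T s 1 + N * T s 2,
          -(3 * f s + 2 * τ⁻¹ * C) * f₁ s * T s 2 - N * T s 1] (γ s) := by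
    rw [h.iteratedDeriv_four hτ hIo hf hf₁ hγ hs, h.iteratedDeriv_two hτ hIo hγ hs, hq, hN]
    simp only [comb, Fin.sum_univ_three, Matrix.cons_val]
    module
  have hS : 1 - C ^ 2 ≠ 0 := by linarith
  have hTS := h.sq s hs
  rw [key, smul_add_comb_eq_zero hτ (hSL s hs), ← hq, ← hN]
  constructor
  · rintro ⟨h1, h2⟩
    have e0 := congrFun h2 0
    have e1 := congrFun h2 1
    have e2 := congrFun h2 2
    simp only [Matrix.cons_val, Pi.zero_apply] at e0 e1 e2
    -- The `E₁` component is `-2τ(1 - C²) f'`, so the turning rate must be constant.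
    have hf0 : f₁ s = 0 :=
      (mul_eq_zero.1 e0).resolve_left (mul_ne_zero (mul_ne_zero (by norm_num) hτ) hS)
    refine ⟨hf0, h1, ?_⟩
    rw [hf0] at e1 e2
    refine (mul_eq_zero.1 (?_ : (1 - C ^ 2) * N = 0)).resolve_left hS
    linear_combination -N * hTS + T s 2 * e1 - T s 1 * e2
  · rintro ⟨h1, h2, h3⟩
    refine ⟨h2, ?_⟩
    rw [h1, h3]
    ext k
    fin_cases k <;> simp

end IsHelixOn

/-! ### The constants `a` and `b` -/

theorem aConst_eq (τ ϑ ε : ℝ) : aConst τ ϑ ε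
    = 1 - Real.cos ϑ ^ 2 - (τ⁻¹ * Real.cos ϑ) ^ 2 - τ⁻¹ * Real.cos ϑ * bConst τ ϑ ε := by
  rw [aConst, Real.cos_two_mul, ← inv_pow]
  ring

theorem discriminant_nonneg {τ C : ℝ} :
    4 * (1 + τ ^ 2) / (4 + 5 * τ ^ 2) ≤ C ^ 2 ↔
      0 ≤ (4 + 5 * τ ^ 2) * C ^ 2 - 4 * (1 + τ ^ 2) := by
  rw [div_le_iff₀ (by positivity), sub_nonneg, mul_comm (C ^ 2)]

theorem bConst_quadratic {τ ϑ ε : ℝ} (hτ : τ ≠ 0) (hε : ε = 1 ∨ ε = -1)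
    (h : 4 * (1 + τ ^ 2) / (4 + 5 * τ ^ 2) ≤ Real.cos ϑ ^ 2) :
    (bConst τ ϑ ε + (2 * τ + 2 * τ⁻¹) * Real.cos ϑ) ^ 2
      - 2 * τ * (bConst τ ϑ ε + (2 * τ + 2 * τ⁻¹) * Real.cos ϑ) * Real.cos ϑ
      + 4 * (1 + τ ^ 2) * (1 - Real.cos ϑ ^ 2) = 0 := by
  have ht : τ⁻¹ * τ = 1 := inv_mul_cancel₀ hτ
  have hsq := Real.sq_sqrt (discriminant_nonneg.1 h)
  have hε2 : ε ^ 2 = 1 := by rcases hε with rfl | rfl <;> norm_num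
  have hu : bConst τ ϑ ε + (2 * τ + 2 * τ⁻¹) * Real.cos ϑ = τ * Real.cos ϑ
      + ε * Real.sqrt ((4 + 5 * τ ^ 2) * Real.cos ϑ ^ 2 - 4 * (1 + τ ^ 2)) := by
    rw [bConst]
    linear_combination -τ * Real.cos ϑ * ht
  rw [hu]
  linear_combination hsq
    + Real.sqrt ((4 + 5 * τ ^ 2) * Real.cos ϑ ^ 2 - 4 * (1 + τ ^ 2)) ^ 2 * hε2

/-- Completing the square shows that the radicand is `(u - τ cos ϑ)²`; the sign of `u - τ cos ϑ`
selects `ε`. -/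
theorem exists_eq_bConst {τ ϑ u : ℝ} (hτ : τ ≠ 0)
    (hu : u ^ 2 - 2 * τ * u * Real.cos ϑ + 4 * (1 + τ ^ 2) * (1 - Real.cos ϑ ^ 2) = 0) :
    4 * (1 + τ ^ 2) / (4 + 5 * τ ^ 2) ≤ Real.cos ϑ ^ 2 ∧
      ∃ ε : ℝ, (ε = 1 ∨ ε = -1) ∧ u - (2 * τ + 2 * τ⁻¹) * Real.cos ϑ = bConst τ ϑ ε := by
  have ht : τ⁻¹ * τ = 1 := inv_mul_cancel₀ hτ
  have hD : (4 + 5 * τ ^ 2) * Real.cos ϑ ^ 2 - 4 * (1 + τ ^ 2) = (u - τ * Real.cos ϑ) ^ 2 := by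
    linear_combination -hu
  refine ⟨discriminant_nonneg.2 (hD ▸ sq_nonneg _), ?_⟩
  rcases le_total 0 (u - τ * Real.cos ϑ) with h | h
  · refine ⟨1, Or.inl rfl, ?_⟩
    rw [bConst, hD, Real.sqrt_sq h]
    linear_combination τ * Real.cos ϑ * ht
  · refine ⟨-1, Or.inr rfl, ?_⟩
    rw [bConst, hD, ← neg_sq (u - _), Real.sqrt_sq (neg_nonneg.2 h)]
    linear_combination τ * Real.cos ϑ * ht

/-- With `c = τ⁻¹ cos ϑ` and `α = 1 - cos² ϑ - c²` one has `a = α - c b`. The expression is `(α -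
a)² + b² (α - (1 - cos² ϑ)) = c² b² - b² c²`. -/
theorem fourth_order_coefficients {τ ϑ ε : ℝ} :
    (1 - Real.cos ϑ ^ 2 - (τ⁻¹ * Real.cos ϑ) ^ 2) ^ 2
        - bConst τ ϑ ε ^ 2 * (1 - Real.cos ϑ ^ 2)
        + (bConst τ ϑ ε ^ 2 - 2 * aConst τ ϑ ε) * (1 - Real.cos ϑ ^ 2 - (τ⁻¹ * Real.cos ϑ) ^ 2)
        + aConst τ ϑ ε ^ 2 = 0 := by
  rw [aConst_eq]
  ring

/-! ### Turning rate and angle function -/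

namespace IsHelixOn

variable {τ C : ℝ} {f : ℝ → ℝ} {γ : ℝ → R4} {T : ℝ → Fin 3 → ℝ} {I : Set ℝ}

/-- A unit field with smooth components and constant first component is a helix. -/
theorem of_const_angle (hIo : IsOpen I) (hT : ∀ k, ContDiffOn ℝ ∞ (fun s => T s k) I)
    (hC : C ^ 2 < 1) (h0 : ∀ s ∈ I, T s 0 = C)
    (hsq : ∀ s ∈ I, T s 1 ^ 2 + T s 2 ^ 2 = 1 - C ^ 2) :
    ∃ f : ℝ → ℝ, ContDiffOn ℝ ∞ f I ∧ IsHelixOn T I C f := by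
  have hS : 1 - C ^ 2 ≠ 0 := by linarith
  have hd : ∀ k, ∀ s ∈ I, HasDerivAt (fun r => T r k) (deriv (fun r => T r k) s) s :=
    fun k s hs => (((hT k).differentiableOn (by simp)).differentiableAt
      (hIo.mem_nhds hs)).hasDerivAt
  have hds : ∀ k, ContDiffOn ℝ ∞ (deriv fun r => T r k) I := fun k =>
    (hT k).deriv_of_isOpen hIo (by simp)
  have horth : ∀ s ∈ I, T s 1 * deriv (fun r => T r 1) s + T s 2 * deriv (fun r => T r 2) s = 0 :=
    fun s hs => by
    have h := deriv_eq_zero_of_eqOn hIo hsq hs (((hd 1 s hs).pow 2).add ((hd 2 s hs).pow 2))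
    simp at h
    linarith
  refine ⟨fun s => (deriv (fun r => T r 1) s * T s 2 - T s 1 * deriv (fun r => T r 2) s)
    / (1 - C ^ 2), (((hds 1).mul (hT 2)).sub ((hT 1).mul (hds 2))).div_const _,
    h0, hsq, fun s hs => (hd 1 s hs).congr_deriv ?_, fun s hs => (hd 2 s hs).congr_deriv ?_⟩
  · field_simp
    linear_combination T s 1 * horth s hs - deriv (fun r => T r 1) s * hsq s hs
  · field_simp
    linear_combination T s 2 * horth s hs - deriv (fun r => T r 2) s * hsq s hs

theorem congr {g : ℝ → ℝ} (h : IsHelixOn T I C f) (hfg : ∀ s ∈ I, f s = g s) :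
    IsHelixOn T I C g :=
  ⟨h.fst, h.sq, fun s hs => hfg s hs ▸ h.deriv_one s hs, fun s hs => hfg s hs ▸ h.deriv_two s hs⟩

/-- A helix of constant angular velocity is parametrized by a linear angle function. -/
theorem exists_angle {b ϑ : ℝ} (hIo : IsOpen I) (hIc : I.OrdConnected) (hIne : I.Nonempty)
    (hϑ : 0 ≤ Real.sin ϑ) (h : IsHelixOn T I (Real.cos ϑ) fun _ => b) :
    ∃ β₀ : ℝ, ∀ s ∈ I, T s 1 = Real.sin ϑ * Real.sin (b * s + β₀) ∧
      T s 2 = Real.sin ϑ * Real.cos (b * s + β₀) := by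
  obtain ⟨s₀, hs₀⟩ := hIne
  obtain ⟨φ, hφ1, hφ2⟩ : ∃ φ, T s₀ 1 = Real.sin ϑ * Real.sin φ ∧
      T s₀ 2 = Real.sin ϑ * Real.cos φ := by
    have hn : ‖(⟨T s₀ 2, T s₀ 1⟩ : ℂ)‖ = Real.sin ϑ := by
      rw [Complex.norm_eq_sqrt_sq_add_sq, ← Real.sqrt_sq hϑ]
      congr 1
      linear_combination h.sq s₀ hs₀ - Real.sin_sq_add_cos_sq ϑ
    refine ⟨Complex.arg ⟨T s₀ 2, T s₀ 1⟩, ?_, ?_⟩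
    · rw [← hn, Complex.norm_mul_sin_arg]
    · rw [← hn, Complex.norm_mul_cos_arg]
  have hβ : ∀ s, HasDerivAt (fun r => b * r + (φ - b * s₀)) b s := fun s =>
    (((hasDerivAt_id s).const_mul b).add_const _).congr_deriv (by simp)
  -- Seen in a frame rotating at rate `b`, `(T₁, T₂)` is constant; `h1` and `h2` are its two
  -- coordinates there.
  have h1 : ∀ s ∈ I, T s 1 * Real.sin (b * s + (φ - b * s₀))
      + T s 2 * Real.cos (b * s + (φ - b * s₀)) = Real.sin ϑ := fun s hs => by
    have hc := eq_of_hasDerivAt_zero hIo hIc (f := fun s => T s 1 * Real.sin (b * s + (φ - b * s₀))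
      + T s 2 * Real.cos (b * s + (φ - b * s₀))) (fun r hr =>
        (((h.deriv_one r hr).mul (hβ r).sin).add
          ((h.deriv_two r hr).mul (hβ r).cos)).congr_deriv (by ring)) hs hs₀
    simp only [add_sub_cancel, hφ1, hφ2] at hc
    linear_combination hc + Real.sin ϑ * Real.sin_sq_add_cos_sq φ
  have h2 : ∀ s ∈ I, T s 1 * Real.cos (b * s + (φ - b * s₀))
      - T s 2 * Real.sin (b * s + (φ - b * s₀)) = 0 := fun s hs => by
    have hc := eq_of_hasDerivAt_zero hIo hIc (f := fun s => T s 1 * Real.cos (b * s + (φ - b * s₀))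
      - T s 2 * Real.sin (b * s + (φ - b * s₀))) (fun r hr =>
        (((h.deriv_one r hr).mul (hβ r).cos).sub
          ((h.deriv_two r hr).mul (hβ r).sin)).congr_deriv (by ring)) hs hs₀
    simp only [add_sub_cancel, hφ1, hφ2] at hc
    linear_combination hc
  refine ⟨φ - b * s₀, fun s hs => ⟨?_, ?_⟩⟩
  · linear_combination Real.sin (b * s + (φ - b * s₀)) * h1 s hs
      + Real.cos (b * s + (φ - b * s₀)) * h2 s hs
      - T s 1 * Real.sin_sq_add_cos_sq (b * s + (φ - b * s₀))
  · linear_combination Real.cos (b * s + (φ - b * s₀)) * h1 s hs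
      - Real.sin (b * s + (φ - b * s₀)) * h2 s hs
      - T s 2 * Real.sin_sq_add_cos_sq (b * s + (φ - b * s₀))

end IsHelixOn

/-! ### The two equivalences with helices -/

section Main

variable {τ : ℝ} {γ : ℝ → R4} {I : Set ℝ}

theorem hasDerivAt_comb_velocity (hτ : τ ≠ 0) (hIo : IsOpen I) (hγ : ContDiffOn ℝ ∞ γ I)
    (hSL : ∀ s ∈ I, γ s ∈ SL2) {s : ℝ} (hs : s ∈ I) :
    HasDerivAt γ (comb τ (velocity τ γ s) (γ s)) s := by
  rw [← deriv_eq_comb_velocity hτ hIo hγ hSL hs]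
  exact ((hγ.differentiableOn (by simp)).differentiableAt (hIo.mem_nhds hs)).hasDerivAt

/-- The fourth order equation with constant Hopf angle forces the angular velocity `bConst`. -/
theorem SatisfiesODEOn.isHelixOn {ϑ ε : ℝ} (hτ : τ ≠ 0) (hIo : IsOpen I)
    (hγ : ContDiffOn ℝ ∞ γ I) (hSL : ∀ s ∈ I, γ s ∈ SL2)
    (harc : ∀ s ∈ I, metric τ (γ s) (deriv γ s) (deriv γ s) = 1)
    (h : SatisfiesODEOn τ γ I ϑ ε) :
    IsHelixOn (velocity τ γ) I (Real.cos ϑ) fun _ => bConst τ ϑ ε := by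
  obtain ⟨hang, hlow, hC, hode⟩ := h
  have h0 : ∀ s ∈ I, velocity τ γ s 0 = Real.cos ϑ := hang
  have hsq : ∀ s ∈ I, velocity τ γ s 1 ^ 2 + velocity τ γ s 2 ^ 2 = 1 - Real.cos ϑ ^ 2 :=
    fun s hs => by
    have := sum_velocity_sq hτ hIo hγ hSL hs (harc s hs)
    rw [h0 s hs] at this
    linarith
  obtain ⟨f, hf, hh⟩ := IsHelixOn.of_const_angle hIo (contDiffOn_velocity hIo hγ) hC h0 hsq
  have hf' : ContDiffOn ℝ ∞ (deriv f) I := hf.deriv_of_isOpen hIo (by simp)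
  have hd : ∀ s ∈ I, HasDerivAt f (deriv f s) s := fun s hs =>
    ((hf.differentiableOn (by simp)).differentiableAt (hIo.mem_nhds hs)).hasDerivAt
  have hd' : ∀ s ∈ I, HasDerivAt (deriv f) (deriv (deriv f) s) s := fun s hs =>
    ((hf'.differentiableOn (by simp)).differentiableAt (hIo.mem_nhds hs)).hasDerivAt
  have key := fun s (hs : s ∈ I) => (hh.fourth_order_iff hτ hIo hd hd'
    (fun r hr => hasDerivAt_comb_velocity hτ hIo hγ hSL hr) hSL hC _ _ hs).1 (hode s hs)
  refine hh.congr fun s hs => ?_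
  obtain ⟨-, hα, hN⟩ := key s hs
  rw [deriv_eq_zero_of_eqOn hIo (fun r hr => (key r hr).1) hs (hd' s hs), add_zero] at hN
  have hcos : Real.cos ϑ ≠ 0 := fun h0 => by
    rw [h0] at hlow
    have : 0 < 4 * (1 + τ ^ 2) / (4 + 5 * τ ^ 2) := by positivity
    linarith
  have hS : 1 - Real.cos ϑ ^ 2 ≠ 0 := by linarith
  have hsqb : f s ^ 2 = bConst τ ϑ ε ^ 2 := by
    refine mul_left_cancel₀ hS ?_
    linear_combination fourth_order_coefficients (τ := τ) (ϑ := ϑ) (ε := ε) - hα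
  -- The `γ` component determines `f` only up to sign. For `f = -b` the remaining equation reads `4
  -- τ⁻¹ cos ϑ b² = 0`, and `cos ϑ ≠ 0` by the lower bound, so `b = 0` and the signs agree.
  rcases sq_eq_sq_iff_eq_or_eq_neg.1 hsqb with hb | hb
  · exact hb
  · rw [hb, aConst_eq] at hN
    have h2 : (4 * (τ⁻¹ * Real.cos ϑ)) * bConst τ ϑ ε ^ 2 = 0 := by linear_combination -hN
    have h3 : bConst τ ϑ ε = 0 := pow_eq_zero_iff two_ne_zero |>.1
      ((mul_eq_zero.1 h2).resolve_left
        (mul_ne_zero four_ne_zero (mul_ne_zero (inv_ne_zero hτ) hcos)))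
    rw [hb, h3, neg_zero]

theorem IsHelixOn.satisfiesODEOn {ϑ ε : ℝ} (hτ : τ ≠ 0) (hIo : IsOpen I)
    (hγ : ContDiffOn ℝ ∞ γ I) (hSL : ∀ s ∈ I, γ s ∈ SL2)
    (hlow : 4 * (1 + τ ^ 2) / (4 + 5 * τ ^ 2) ≤ Real.cos ϑ ^ 2) (hC : Real.cos ϑ ^ 2 < 1)
    (h : IsHelixOn (velocity τ γ) I (Real.cos ϑ) fun _ => bConst τ ϑ ε) :
    SatisfiesODEOn τ γ I ϑ ε := by
  refine ⟨h.fst, hlow, hC, fun s hs => ?_⟩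
  refine (h.fourth_order_iff hτ hIo (f₁ := fun _ => 0) (f₂ := fun _ => 0)
    (fun s _ => hasDerivAt_const s _) (fun s _ => hasDerivAt_const s _)
    (fun r hr => hasDerivAt_comb_velocity hτ hIo hγ hSL hr) hSL hC _ _ hs).2 ⟨rfl, ?_, ?_⟩
  · exact fourth_order_coefficients
  · rw [aConst_eq]
    ring

theorem IsHelixOn.isProperBiharmonicOn {ϑ ε : ℝ} (hτ : τ ≠ 0) (hε : ε = 1 ∨ ε = -1)
    (hIo : IsOpen I) (hIne : I.Nonempty) (hγ : ContDiffOn ℝ ∞ γ I) (hSL : ∀ s ∈ I, γ s ∈ SL2)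
    (hlow : 4 * (1 + τ ^ 2) / (4 + 5 * τ ^ 2) ≤ Real.cos ϑ ^ 2) (hC : Real.cos ϑ ^ 2 < 1)
    (h : IsHelixOn (velocity τ γ) I (Real.cos ϑ) fun _ => bConst τ ϑ ε) :
    IsProperBiharmonicOn τ γ I := by
  have hb := bConst_quadratic hτ hε hlow
  refine (isProperBiharmonicOn_iff hτ hIo hγ hSL).2
    ⟨fun s hs => h.biharmonic hIo hτ hb hs, fun hW => ?_⟩
  obtain ⟨s, hs⟩ := hIne
  have hW := hW s hs
  rw [h.covariant_self hIo hs] at hW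
  have e1 := congrFun hW 1
  have e2 := congrFun hW 2
  simp only [Matrix.cons_val, Pi.zero_apply] at e1 e2
  have hS : 1 - Real.cos ϑ ^ 2 ≠ 0 := by linarith
  -- A geodesic would have `u = 0`, but the quadratic has constant term `4(1 + τ²)(1 - cos² ϑ) ≠ 0`.
  have hu : bConst τ ϑ ε + (2 * τ + 2 * τ⁻¹) * Real.cos ϑ = 0 := by
    refine (mul_eq_zero.1 (?_ : (1 - Real.cos ϑ ^ 2) * _ = 0)).resolve_left hS
    linear_combination velocity τ γ s 2 * e1 - velocity τ γ s 1 * e2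
      - (bConst τ ϑ ε + (2 * τ + 2 * τ⁻¹) * Real.cos ϑ) * h.sq s hs
  rw [hu] at hb
  have : (4 * (1 + τ ^ 2)) * (1 - Real.cos ϑ ^ 2) = 0 := by linear_combination hb
  exact mul_ne_zero (by positivity) hS this

theorem IsProperBiharmonicOn.exists_isHelixOn (hτ : 0 < τ) (hIo : IsOpen I) (hIc : I.OrdConnected)
    (hγ : ContDiffOn ℝ ∞ γ I) (hSL : ∀ s ∈ I, γ s ∈ SL2)
    (harc : ∀ s ∈ I, metric τ (γ s) (deriv γ s) (deriv γ s) = 1)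
    (h : IsProperBiharmonicOn τ γ I) :
    ∃ C u : ℝ, C ^ 2 < 1 ∧ u ^ 2 - 2 * τ * u * C + 4 * (1 + τ ^ 2) * (1 - C ^ 2) = 0 ∧
      IsHelixOn (velocity τ γ) I C fun _ => u - (2 * τ + 2 * τ⁻¹) * C := by
  obtain ⟨hbi, hne⟩ := (isProperBiharmonicOn_iff hτ.ne' hIo hγ hSL).1 h
  have hT := contDiffOn_velocity (τ := τ) hIo hγ
  have hW := contDiffOn_covariant (τ := τ) hIo hT hT
  have hY := contDiffOn_covariant (τ := τ) hIo hT hW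
  have hcov : ∀ s ∈ I, HasCovariantAt τ (velocity τ γ s) (velocity τ γ)
      (covariant τ (velocity τ γ) (velocity τ γ) s) s :=
    fun s hs k => hasDerivAt_of_covariant hIo hT hs k
  have hunit := fun s (hs : s ∈ I) => sum_velocity_sq hτ.ne' hIo hγ hSL hs (harc s hs)
  obtain ⟨C, u, hC, hu, hh⟩ := exists_helix_constants hτ hIo hIc
    (fun s hs => by rw [dot]; linear_combination hunit s hs) hcov
    (fun s hs k => hasDerivAt_of_covariant hIo hW hs k)
    (fun s hs k => by rw [← hbi s hs]; exact hasDerivAt_of_covariant hIo hY hs k) hne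
  refine ⟨C, u, hC, hu, fun s hs => (hh s hs).1, fun s hs => ?_, fun s hs => ?_, fun s hs => ?_⟩
  · have := hunit s hs
    rw [(hh s hs).1] at this
    linarith
  · refine (hcov s hs 1).congr_deriv ?_
    simp [connection, (hh s hs).1, (hh s hs).2.1]
    ring
  · refine (hcov s hs 2).congr_deriv ?_
    simp [connection, (hh s hs).1, (hh s hs).2.2]
    ring

end Main

end SLBiharmonic

end

theorem mainTheorem1 (τ : ℝ) (hτ : 0 < τ) (I : Set ℝ) (hIo : IsOpen I) (hIc : I.OrdConnected)
    (hIne : I.Nonempty) (γ : ℝ → SLBiharmonic.R4) (hγ : ContDiffOn ℝ ∞ γ I)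
    (hSL : ∀ s ∈ I, γ s ∈ SLBiharmonic.SL2)
    (harc : ∀ s ∈ I, SLBiharmonic.metric τ (γ s) (deriv γ s) (deriv γ s) = 1) :
    (SLBiharmonic.IsProperBiharmonicOn τ γ I ↔
      ∃ ϑ ∈ Set.Icc 0 Real.pi, ∃ ε : ℝ, (ε = 1 ∨ ε = -1) ∧
        SLBiharmonic.SatisfiesODEOn τ γ I ϑ ε) ∧
    ∀ ϑ ∈ Set.Icc 0 Real.pi, ∀ ε : ℝ, (ε = 1 ∨ ε = -1) →
      SLBiharmonic.SatisfiesODEOn τ γ I ϑ ε →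
      ∃ β : ℝ → ℝ, ContDiffOn ℝ ∞ β I ∧ ∀ s ∈ I,
        deriv γ s = Real.cos ϑ • SLBiharmonic.frame τ 0 (γ s)
          + (Real.sin ϑ * Real.sin (β s)) • SLBiharmonic.frame τ 1 (γ s)
          + (Real.sin ϑ * Real.cos (β s)) • SLBiharmonic.frame τ 2 (γ s) ∧
        deriv β s = SLBiharmonic.bConst τ ϑ ε := by
  refine ⟨⟨fun h => ?_, ?_⟩, ?_⟩
  · obtain ⟨C, u, hC, hu, hh⟩ := h.exists_isHelixOn hτ hIo hIc hγ hSL harc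
    have hC' := abs_le.1 ((sq_lt_one_iff_abs_lt_one C).1 hC).le
    have hcos : Real.cos (Real.arccos C) = C := Real.cos_arccos hC'.1 hC'.2
    rw [← hcos] at hC hu hh
    obtain ⟨hlow, ε, hε, hb⟩ := SLBiharmonic.exists_eq_bConst hτ.ne' hu
    rw [hb] at hh
    exact ⟨Real.arccos C, ⟨Real.arccos_nonneg C, Real.arccos_le_pi C⟩, ε, hε,
      hh.satisfiesODEOn hτ.ne' hIo hγ hSL hlow hC⟩
  · rintro ⟨ϑ, -, ε, hε, h⟩
    exact (h.isHelixOn hτ.ne' hIo hγ hSL harc).isProperBiharmonicOn hτ.ne' hε hIo hIne hγ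
      hSL h.2.1 h.2.2.1
  · intro ϑ hϑ ε hε h
    have hh := h.isHelixOn hτ.ne' hIo hγ hSL harc
    obtain ⟨β₀, hβ⟩ := hh.exists_angle hIo hIc hIne (Real.sin_nonneg_of_mem_Icc hϑ)
    refine ⟨fun s => SLBiharmonic.bConst τ ϑ ε * s + β₀, by fun_prop, fun s hs => ⟨?_, ?_⟩⟩
    · rw [SLBiharmonic.deriv_eq_comb_velocity hτ.ne' hIo hγ hSL hs, SLBiharmonic.comb,
        Fin.sum_univ_three, hh.fst s hs, (hβ s hs).1, (hβ s hs).2]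
    · simp
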